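/- A dissection of the unit square $[0,1]^2$ into $n$ triangles consists of $n$ nondegenerate triangles with pairwise disjoint interiors whose union is the square. Its range is $\operatorname{range}(D)=\max_{i,j}|a_i-a_j|$, where $a_1,\dots,a_n$ are the areas of the triangles, and $\Delta(n)$ denotes the infimum of $\operatorname{range}(D)$ over all dissections $D$ of the unit square into $n$ triangles. The Thue–Morse sign sequence is given by $s_1=+1$, $s_{2j-1}=s_j$, $s_{2j}=-s_j$ for $j\ge 1$. For odd $n\ge 3$ put $N=2^{\lfloor\log_2 n\rfloor}$ and $m=(n-N-1)/2$, and let $p_i$ and $q_i$ be the numbers of indices $j\in\{1,\dots,i\}$ with $s_j=+1$ and $s_j=-1$, respectively (so $p_N=q_N=N/2$). Let $D_n$ be the following combinatorial type of dissections of the unit square into $n$ triangles. The nodes are $S_0,\dots,S_{N/2}$, $B_0,\dots,B_{N/2+m}$ and $T_0,\dots,T_m$, and the triangles are * the flat top triangle $S_0S_{N/2}T_0$; * for $i=1,\dots,N$, the strip triangle with corners $S_{p_{i-1}}$, $B_{q_{i-1}}$ and, as third corner, $S_{p_i}$ if $s_i=+1$ and $B_{q_i}$ if $s_i=-1$; *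 for $j=0,\dots,m-1$, the two triangles $T_jB_{N/2+j}T_{j+1}$ and $B_{N/2+j}T_{j+1}B_{N/2+j+1}$. The corners of the square are $S_0=(0,1)$, $B_0=(0,0)$, $B_{N/2+m}=(1,0)$ and $T_m=(1,1)$. The nodes $S_0,S_1,\dots,S_{N/2}$ lie in this order on a line, as do $B_0,B_1,\dots,B_{N/2+m}$ (on the bottom side of the square) and $S_0,T_0,T_1,\dots,T_m$ (on its top side), and $S_{N/2}$ lies strictly between $T_0$ and $B_{N/2}$. Theorem. There are constants $C,C'>0$ such that, for every odd $n\ge3$, the nodes of $D_n$ can be placed so that a dissection of the unit square of type $D_n$ results whose range satisfies $$\operatorname{range}(D_n)\le \frac{8n^4}{n^{\log_2 n}\,\log_2 n}\Bigl(1+C\,\frac{\log n}{n}\Bigr)=\frac1{n^{\log_2 n-c_n}}\qquad\text{with } |c_n|\le C'.$$ Consequently there is a constant $c>0$ such that $\Delta(n)\le 2^{-c\,(\log_2 n)^2}$ for every odd $n\ge3$. -/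

import Mathlib

/-- The Thue–Morse sign sequence `s₁ s₂ s₃ …`, given by `s₁ = 1`, `s_{2j-1} = s_j` and
`s_{2j} = -s_j`. The value at the index `0` is not used. -/
def thueMorse : ℕ → ℤ
  | 0 => 0
  | 1 => 1
  | i + 2 =>
      if (i + 2) % 2 = 0 then -thueMorse ((i + 2) / 2) else thueMorse ((i + 3) / 2)
  decreasing_by all_goals omega

theorem thueMorse_one : thueMorse 1 = 1 := by
  rw [thueMorse]

theorem thueMorse_odd (j : ℕ) (hj : 1 ≤ j) : thueMorse (2 * j - 1) = thueMorse j := by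
  obtain rfl | ⟨i, rfl⟩ : j = 1 ∨ ∃ i, j = i + 2 := by
    rcases Nat.lt_or_ge j 2 with h | h
    · left; omega
    · right; exact ⟨j - 2, by omega⟩
  · rfl
  · rw [show 2 * (i + 2) - 1 = (2 * i + 1) + 2 by omega, thueMorse,
      if_neg (by omega), show (2 * i + 1 + 3) / 2 = i + 2 by omega]

theorem thueMorse_even (j : ℕ) (hj : 1 ≤ j) : thueMorse (2 * j) = -thueMorse j := by
  obtain ⟨i, rfl⟩ : ∃ i, j = i + 1 := ⟨j - 1, by omega⟩
  rw [show 2 * (i + 1) = 2 * i + 2 by omega, thueMorse,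
    if_pos (by omega), show (2 * i + 2) / 2 = i + 1 by omega]

/-- The closed unit square with corners `(0,0)`, `(1,0)`, `(1,1)`, `(0,1)`. -/
def unitSquare : Set (ℝ × ℝ) := Set.Icc 0 1 ×ˢ Set.Icc 0 1

/-- A dissection of a region `S` of the plane into `n` (nondegenerate) triangles: they have
pairwise disjoint interiors and their union is `S`. The triangle with index `i` has the three
corners `corner i 0`, `corner i 1`, `corner i 2`. -/
structure Dissection (S : Set (ℝ × ℝ)) (n : ℕ) where
  corner : Fin n → Fin 3 → ℝ × ℝ
  nondegenerate : ∀ i, AffineIndependent ℝ (corner i)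
  disjoint_interiors : ∀ i j, i ≠ j →
    Disjoint (interior (convexHull ℝ (Set.range (corner i))))
      (interior (convexHull ℝ (Set.range (corner j))))
  cover : ⋃ i, convexHull ℝ (Set.range (corner i)) = S

/-- The area of the `i`-th triangle. -/
noncomputable def Dissection.area {S : Set (ℝ × ℝ)} {n : ℕ} (D : Dissection S n)
    (i : Fin n) : ℝ :=
  (MeasureTheory.volume (convexHull ℝ (Set.range (D.corner i)))).toReal

/-- The range of areas `max_{i,j} |a_i - a_j|`. -/
noncomputable def Dissection.areaRange {S : Set (ℝ × ℝ)} {n : ℕ} (D : Dissection S n) : ℝ :=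
  ⨆ p : Fin n × Fin n, |D.area p.1 - D.area p.2|

/-- `Δ(n)`: the infimum of the range of areas over all dissections of the unit square into `n`
triangles. -/
noncomputable def minAreaRange (n : ℕ) : ℝ :=
  ⨅ D : Dissection unitSquare n, D.areaRange

/-- The labels of the nodes of the dissections `D_n`.
* `slant 0, slant 1, …` are the nodes on the slanted lower side of the flat top triangle, from
  left to right; `slant 0` is the upper left corner of the square;
* `bottom 0, bottom 1, …` are the nodes on the bottom side of the square, from left to right;
* `top 0, top 1, …` are the nodes on the top side of the square, other than its left end, from
  left to right; `top 0` is the third corner of the flat top triangle. -/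
inductive StripNode where
  | slant (j : ℕ)
  | bottom (j : ℕ)
  | top (j : ℕ)

/-- The number `2 ^ ⌊log₂ n⌋` of triangles in the strip below the flat top triangle. -/
def stripLength (n : ℕ) : ℕ := 2 ^ Nat.log 2 n

/-- Half the number `n - 2 ^ ⌊log₂ n⌋ - 1` of triangles to the right of the flat top triangle
and of the strip below it. -/
def extraPairs (n : ℕ) : ℕ := (n - stripLength n - 1) / 2

/-- The number of indices `j ∈ {1, …, i}` with `s_j = +1`. -/
def plusCount (i : ℕ) : ℕ := ((Finset.Icc 1 i).filter fun j => thueMorse j = 1).card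

/-- The number of indices `j ∈ {1, …, i}` with `s_j = -1`. -/
def minusCount (i : ℕ) : ℕ := ((Finset.Icc 1 i).filter fun j => thueMorse j = -1).card

/-- The corners of the `i`-th triangle of the strip (`i ≥ 1`). The triangles are cut off from
left to right; the triangles `1, …, i - 1` end at the edge from `slant (plusCount (i - 1))` to
`bottom (minusCount (i - 1))`, and the `i`-th triangle has this edge as a side. Its remaining
corner is the next node on the slanted line if `s_i = +1`, and the next node on the bottom side
if `s_i = -1`. -/
def stripTriangle (i : ℕ) : Fin 3 → StripNode :=
  ![.slant (plusCount (i - 1)), .bottom (minusCount (i - 1)),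
    if thueMorse i = 1 then .slant (plusCount i) else .bottom (minusCount i)]

/-- The triangles of `D_n`, as triples of nodes: the flat top triangle (index `0`), the triangles
of the strip (indices `1, …, 2 ^ ⌊log₂ n⌋`), and the remaining triangles, which come in pairs
`top j, bottom b, top (j + 1)` and `bottom b, top (j + 1), bottom (b + 1)` from left to right. -/
def nodeTriple (n : ℕ) (i : ℕ) : Fin 3 → StripNode :=
  if i = 0 then
    ![.slant 0, .slant (stripLength n / 2), .top 0]
  else if i ≤ stripLength n then
    stripTriangle i
  else
    let r := i - stripLength n - 1
    let j := r / 2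
    let b := stripLength n / 2 + j
    if r % 2 = 0 then ![.top j, .bottom b, .top (j + 1)]
    else ![.bottom b, .top (j + 1), .bottom (b + 1)]

/-- The points `f 0, …, f N` lie on a line, in this order, and are distinct if `N ≥ 2`. -/
def InLineUpTo (N : ℕ) (f : ℕ → ℝ × ℝ) : Prop :=
  ∀ i j l : ℕ, i < j → j < l → l ≤ N → Sbtw ℝ (f i) (f j) (f l)

/-- The dissection `D` of the unit square is obtained by placing the nodes of `D_n` at the
points `P`: the triangles of `D` are the prescribed ones, the four corner nodes are at the
corners of the square, and the nodes lie on the sides of the triangles and of the square as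
prescribed by `D_n`. -/
structure IsPlacementOfDn {n : ℕ} (D : Dissection unitSquare n) (P : StripNode → ℝ × ℝ) :
    Prop where
  corner_eq : ∀ (i : Fin n) (v : Fin 3), D.corner i v = P (nodeTriple n i v)
  upper_left : P (.slant 0) = (0, 1)
  lower_left : P (.bottom 0) = (0, 0)
  lower_right : P (.bottom (stripLength n / 2 + extraPairs n)) = (1, 0)
  upper_right : P (.top (extraPairs n)) = (1, 1)
  slant_line : InLineUpTo (stripLength n / 2) fun j => P (.slant j)
  bottom_line : InLineUpTo (stripLength n / 2 + extraPairs n) fun j => P (.bottom j)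
  top_line : InLineUpTo (extraPairs n + 1) fun j =>
    if j = 0 then P (.slant 0) else P (.top (j - 1))
  strip_end : Sbtw ℝ (P (.top 0)) (P (.slant (stripLength n / 2)))
    (P (.bottom (stripLength n / 2)))

/-- The bound `8 n⁴ / (n ^ (log₂ n) · log₂ n) · (1 + C · log n / n)`. -/
noncomputable def superpolyBound (C : ℝ) (n : ℕ) : ℝ :=
  8 * (n : ℝ) ^ 4 / ((n : ℝ) ^ Real.logb 2 n * Real.logb 2 n) * (1 + C * (Real.log n / n))

/-! Extend the slanted line until it meets the bottom line in an apex, and measure the nodes of the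
strip by their distance from the apex, relative to the left end. An edge between nodes at relative
distances `u` and `v` spans with the apex a triangle of area proportional to `u * v`. Cutting off
equal areas therefore means that `u * v` runs through `1, 1 - x, 1 - 2x, …`: step `i` multiplies one
of `u`, `v` by `(1 - i x) / (1 - (i - 1) x)`, and the sign `s_i` chooses which. The flat top
triangle and the pairs on the right can be given exactly the average area. The only obstruction to
equal areas is that the strip must end in a vertical edge, that is, that the final values of `u` and
`v` (`plusProd` and `minusProd`) must agree.

The logarithm of their quotient is the Thue–Morse sum of `f(i) = log (1 - i x) - log (1 - (i - 1)
x)` over `i ≤ 2 ^ k`. Such a sum is a `k`-fold difference with steps `1, 2, 4, …`, so it is at most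
`2 ^ (k (k - 1) / 2)` times a bound for the `k`-th derivative (`abs_thueMorse_sum_le`). That
derivative is at most about `(k - 1)! x ^ k` with `x` of order `4 ^ (-k)`. The mismatch is thus `2 ^
(-(3/2) k ^ 2 + O(k log k))`, well below `n ^ (-log₂ n) ≥ 2 ^ (-(k + 1) ^ 2)`.

The mismatch is repaired by moving the last node on either line to the geometric mean `ρ` of the two
final values. This leaves the total area of the strip unchanged and affects only its last two
triangles, by an amount controlled by the mismatch (`StripParams.abs_restArea_sub_sub_le`). The
nodes stay in order because the two products never drift far apart (`plusProd_le_minusProd`,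
`StripParams.rho_lt`). For the dissection property it suffices that the triangles cover the square:
since their areas add up to `1`, their interiors are then disjoint (`disjoint_interior_of_cover`).
-/

/-! ### Signs of the Thue–Morse sequence and their counts -/

theorem thueMorse_eq_one_or_neg_one (i : ℕ) (hi : 1 ≤ i) :
    thueMorse i = 1 ∨ thueMorse i = -1 := by
  induction i using Nat.strong_induction_on with
  | _ i ih =>
    rcases Nat.lt_or_ge i 2 with h | h
    · obtain rfl : i = 1 := by omega
      exact Or.inl thueMorse_one
    · rcases Nat.even_or_odd' i with ⟨j, rfl | rfl⟩
      · have := ih j (by omega) (by omega)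
        rw [thueMorse_even j (by omega)]
        omega
      · have := ih (j + 1) (by omega) (by omega)
        rwa [show 2 * j + 1 = 2 * (j + 1) - 1 by omega, thueMorse_odd (j + 1) (by omega)]

theorem thueMorse_two_mul_add_two (l : ℕ) : thueMorse (2 * l + 2) = -thueMorse (2 * l + 1) := by
  have h₁ := thueMorse_even (l + 1) (by omega)
  have h₂ := thueMorse_odd (l + 1) (by omega)
  rw [show 2 * (l + 1) = 2 * l + 2 by ring] at h₁
  rw [show 2 * (l + 1) - 1 = 2 * l + 1 by omega] at h₂
  rw [h₁, h₂]

theorem plusCount_succ (i : ℕ) :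
    plusCount (i + 1) = plusCount i + if thueMorse (i + 1) = 1 then 1 else 0 := by
  simp only [plusCount, Finset.card_filter]
  rw [Finset.sum_Icc_succ_top (by omega)]

theorem minusCount_succ (i : ℕ) :
    minusCount (i + 1) = minusCount i + if thueMorse (i + 1) = -1 then 1 else 0 := by
  simp only [minusCount, Finset.card_filter]
  rw [Finset.sum_Icc_succ_top (by omega)]

/-- The signs come in consecutive pairs of opposite signs. -/
theorem plusCount_two_mul (l : ℕ) : plusCount (2 * l) = l := by
  induction l with
  | zero => simp [plusCount]
  | succ l ih =>
    rw [show 2 * (l + 1) = 2 * l + 1 + 1 by ring, plusCount_succ, plusCount_succ, ih,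
      show 2 * l + 1 + 1 = 2 * l + 2 by ring, thueMorse_two_mul_add_two]
    rcases thueMorse_eq_one_or_neg_one (2 * l + 1) (by omega) with h | h <;> simp [h]

theorem minusCount_two_mul (l : ℕ) : minusCount (2 * l) = l := by
  induction l with
  | zero => simp [minusCount]
  | succ l ih =>
    rw [show 2 * (l + 1) = 2 * l + 1 + 1 by ring, minusCount_succ, minusCount_succ, ih,
      show 2 * l + 1 + 1 = 2 * l + 2 by ring, thueMorse_two_mul_add_two]
    rcases thueMorse_eq_one_or_neg_one (2 * l + 1) (by omega) with h | h <;> simp [h]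

/-! ### Thue–Morse sums as iterated differences -/

theorem thueMorse_sum_two_mul (M : ℕ) (h : ℕ → ℝ) :
    ∑ i ∈ Finset.Icc 1 (2 * M), (thueMorse i : ℝ) * h i =
      ∑ j ∈ Finset.Icc 1 M, (thueMorse j : ℝ) * (h (2 * j - 1) - h (2 * j)) := by
  induction M with
  | zero => simp
  | succ M ih =>
    rw [show 2 * (M + 1) = 2 * M + 1 + 1 by ring, Finset.sum_Icc_succ_top (by omega),
      Finset.sum_Icc_succ_top (by omega), Finset.sum_Icc_succ_top (by omega), ih,
      show 2 * M + 1 + 1 = 2 * (M + 1) by ring, thueMorse_even (M + 1) (by omega),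
      show 2 * (M + 1) - 1 = 2 * M + 1 by omega, show 2 * M + 1 = 2 * (M + 1) - 1 by omega,
      thueMorse_odd (M + 1) (by omega)]
    push_cast
    ring

/-- A sum over `2 ^ k` terms with Thue–Morse signs is an iterated difference, and is bounded by
the `k`-th derivative. The functions `H 1, H 2, …` are the successive derivatives of `H 0`. -/
theorem abs_thueMorse_sum_le (k : ℕ) (H : ℕ → ℝ → ℝ) (B : ℝ)
    (hd : ∀ r < k, ∀ t ∈ Set.Icc (1 : ℝ) (2 ^ k), HasDerivAt (H r) (H (r + 1) t) t)
    (hB : ∀ t ∈ Set.Icc (1 : ℝ) (2 ^ k), |H k t| ≤ B) :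
    |∑ i ∈ Finset.Icc 1 (2 ^ k), (thueMorse i : ℝ) * H 0 i| ≤ B * 2 ^ (k * (k - 1) / 2) := by
  induction k generalizing H B with
  | zero => simpa [thueMorse_one] using hB 1 (by simp)
  | succ k ih =>
    have hmem : ∀ y ∈ Set.Icc (1 : ℝ) (2 ^ k),
        2 * y - 1 ∈ Set.Icc (1 : ℝ) (2 ^ (k + 1)) ∧ 2 * y ∈ Set.Icc (1 : ℝ) (2 ^ (k + 1)) := by
      rintro y ⟨h1, h2⟩
      rw [pow_succ]
      refine ⟨⟨?_, ?_⟩, ?_, ?_⟩ <;> linarith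
    -- Pairing the terms `2 j - 1` and `2 j` gives a sum of half the length for `y ↦ H 0 (2 y - 1) -
    -- H 0 (2 y)`. Its `r`-th derivative carries the factor `2 ^ r` from the inner slope `2`.
    have key := ih (fun r y => 2 ^ r * (H r (2 * y - 1) - H r (2 * y))) (2 ^ k * B) ?_ ?_
    · rw [pow_succ, mul_comm (2 ^ k) 2, thueMorse_sum_two_mul (2 ^ k) fun i => H 0 i]
      convert key using 1
      · congr 1
        refine Finset.sum_congr rfl fun j hj => ?_
        have : 1 ≤ j := (Finset.mem_Icc.mp hj).1
        rw [Nat.cast_sub (by omega)]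
        push_cast
        ring_nf
      · have : (k + 1) * (k + 1 - 1) / 2 = k + k * (k - 1) / 2 := by
          rw [← Nat.mul_add_div (by norm_num : 0 < 2)]
          congr 1
          rcases k with _ | k
          · rfl
          · simp only [Nat.add_sub_cancel]
            ring
        rw [this, pow_add]
        ring
    · intro r hr y hy
      have e1 : HasDerivAt (fun y : ℝ => 2 * y - 1) 2 y := by
        simpa using ((hasDerivAt_id y).const_mul 2).sub_const 1
      have e2 : HasDerivAt (fun y : ℝ => 2 * y) 2 y := by
        simpa using (hasDerivAt_id y).const_mul 2
      have h1 := (hd r (by omega) _ (hmem y hy).1).comp y e1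
      have h2 := (hd r (by omega) _ (hmem y hy).2).comp y e2
      exact ((h1.sub h2).const_mul (2 ^ r)).congr_deriv (by rw [pow_succ]; ring)
    · intro y hy
      -- Mean value inequality: `2 y - 1` and `2 y` are at distance `1`, so the difference costs one
      -- derivative and no further factor.
      have := (convex_Icc (1 : ℝ) (2 ^ (k + 1))).norm_image_sub_le_of_norm_hasDerivWithin_le
        (fun t ht => (hd k (by omega) t ht).hasDerivWithinAt) hB (hmem y hy).2 (hmem y hy).1
      rw [abs_mul, abs_of_pos (by positivity : (0 : ℝ) < 2 ^ k)]
      gcongr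
      simpa using this

/-- The successive derivatives of `t ↦ log (1 - t x) - log (1 - (t - 1) x)`. -/
noncomputable def logStepDeriv (x : ℝ) : ℕ → ℝ → ℝ
  | 0, t => Real.log (1 - t * x) - Real.log (1 - (t - 1) * x)
  | r + 1, t =>
      -(r.factorial * x ^ (r + 1)) *
        (((1 - t * x) ^ (r + 1))⁻¹ - ((1 - (t - 1) * x) ^ (r + 1))⁻¹)

theorem hasDerivAt_logStepDeriv (x : ℝ) (r : ℕ) (t : ℝ) (h₁ : 0 < 1 - t * x)
    (h₂ : 0 < 1 - (t - 1) * x) :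
    HasDerivAt (logStepDeriv x r) (logStepDeriv x (r + 1) t) t := by
  have e₁ : HasDerivAt (fun t : ℝ => 1 - t * x) (-x) t := by
    simpa using ((hasDerivAt_id t).mul_const x).const_sub 1
  have e₂ : HasDerivAt (fun t : ℝ => 1 - (t - 1) * x) (-x) t := by
    simpa using (((hasDerivAt_id t).sub_const 1).mul_const x).const_sub 1
  cases r with
  | zero =>
    refine ((e₁.log h₁.ne').sub (e₂.log h₂.ne')).congr_deriv ?_
    simp only [logStepDeriv, Nat.factorial_zero, Nat.cast_one, zero_add, pow_one, div_eq_mul_inv]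
    ring
  | succ r =>
    refine ((((e₁.pow (r + 1)).inv (pow_ne_zero _ h₁.ne')).sub
      ((e₂.pow (r + 1)).inv (pow_ne_zero _ h₂.ne'))).const_mul
      (-(r.factorial * x ^ (r + 1)))).congr_deriv ?_
    simp only [logStepDeriv, Nat.factorial_succ, Nat.cast_mul, Nat.add_sub_cancel, Nat.cast_add,
      Nat.cast_one, Pi.pow_apply]
    generalize 1 - t * x = p at *
    generalize 1 - (t - 1) * x = q at *
    field_simp
    ring

/-- The `k`-th derivative is `(k - 1)! x ^ k` times a difference of two positive reciprocals, each
at most `δ ^ (-k)`; hence so is the difference, without a factor `2`. -/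
theorem abs_thueMorse_log_sum_le (k : ℕ) (hk : 1 ≤ k) (x δ : ℝ) (hx : 0 < x) (hδ : 0 < δ)
    (h : δ ≤ 1 - 2 ^ k * x) :
    |∑ i ∈ Finset.Icc 1 (2 ^ k), (thueMorse i : ℝ) *
      (Real.log (1 - i * x) - Real.log (1 - (i - 1) * x))| ≤
      (k - 1).factorial * (x / δ) ^ k * 2 ^ (k * (k - 1) / 2) := by
  have hpos : ∀ t ∈ Set.Icc (1 : ℝ) (2 ^ k), δ ≤ 1 - t * x ∧ δ ≤ 1 - (t - 1) * x := by
    rintro t ⟨-, ht⟩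
    have : t * x ≤ 2 ^ k * x := by gcongr
    constructor <;> nlinarith
  refine abs_thueMorse_sum_le k (logStepDeriv x) _ (fun r _ t ht => ?_) fun t ht => ?_
  · exact hasDerivAt_logStepDeriv x r t (hδ.trans_le (hpos t ht).1) (hδ.trans_le (hpos t ht).2)
  · obtain ⟨h₁, h₂⟩ := hpos t ht
    obtain ⟨r, rfl⟩ : ∃ r, k = r + 1 := ⟨k - 1, by omega⟩
    have b₁ : ((1 - t * x) ^ (r + 1))⁻¹ ≤ (δ ^ (r + 1))⁻¹ := by gcongr
    have b₂ : ((1 - (t - 1) * x) ^ (r + 1))⁻¹ ≤ (δ ^ (r + 1))⁻¹ := by gcongr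
    have c₁ : 0 ≤ ((1 - t * x) ^ (r + 1))⁻¹ := by
      have := hδ.trans_le h₁
      positivity
    have c₂ : 0 ≤ ((1 - (t - 1) * x) ^ (r + 1))⁻¹ := by
      have := hδ.trans_le h₂
      positivity
    simp only [logStepDeriv, Nat.add_sub_cancel, abs_mul, abs_neg]
    rw [Nat.abs_cast, abs_of_pos (pow_pos hx _), div_pow, div_eq_mul_inv, ← mul_assoc]
    gcongr
    rw [abs_le]
    constructor <;> linarith

/-! ### Areas of triangles and disjointness of interiors -/

theorem mem_convexHull_triple {E : Type*} [AddCommGroup E] [Module ℝ E] (f : Fin 3 → E)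
    {a b c : ℝ} (ha : 0 ≤ a) (hb : 0 ≤ b) (hc : 0 ≤ c) (h : a + b + c = 1) :
    a • f 0 + b • f 1 + c • f 2 ∈ convexHull ℝ (Set.range f) := by
  have := (convex_convexHull ℝ (Set.range f)).sum_mem (t := Finset.univ) (w := ![a, b, c])
    (z := f) ?_ ?_ ?_
  · simpa [Fin.sum_univ_three] using this
  · intro i _
    fin_cases i <;> simpa
  · simpa [Fin.sum_univ_three] using h
  · exact fun i _ => subset_convexHull ℝ _ ⟨i, rfl⟩

/-- Twice the signed area of a triangle. -/
def doubleArea (f : Fin 3 → ℝ × ℝ) : ℝ :=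
  ((f 1).1 - (f 0).1) * ((f 2).2 - (f 0).2) - ((f 1).2 - (f 0).2) * ((f 2).1 - (f 0).1)

theorem convexHull_standard_triangle :
    convexHull ℝ (Set.range ![((0 : ℝ), (0 : ℝ)), (1, 0), (0, 1)]) =
      {p : ℝ × ℝ | 0 ≤ p.1 ∧ 0 ≤ p.2 ∧ p.1 + p.2 ≤ 1} := by
  apply subset_antisymm
  · refine convexHull_min ?_ ?_
    · rintro _ ⟨i, rfl⟩
      fin_cases i <;> norm_num
    · rintro p ⟨h1, h2, h3⟩ q ⟨h4, h5, h6⟩ a b ha hb hab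
      refine ⟨?_, ?_, ?_⟩
      · simp only [Prod.fst_add, Prod.smul_fst, smul_eq_mul]; positivity
      · simp only [Prod.snd_add, Prod.smul_snd, smul_eq_mul]; positivity
      · simp only [Prod.fst_add, Prod.smul_fst, smul_eq_mul, Prod.snd_add, Prod.smul_snd]
        nlinarith
  · rintro ⟨p, q⟩ ⟨h1, h2, h3⟩
    have := mem_convexHull_triple ![((0 : ℝ), (0 : ℝ)), (1, 0), (0, 1)]
      (a := 1 - p - q) (b := p) (c := q) (by simp at h3; linarith) h1 h2 (by ring)
    simpa using this

theorem volume_standard_triangle :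
    MeasureTheory.volume {p : ℝ × ℝ | 0 ≤ p.1 ∧ 0 ≤ p.2 ∧ p.1 + p.2 ≤ 1} =
      ENNReal.ofReal (1 / 2) := by
  have hm : MeasurableSet {p : ℝ × ℝ | 0 ≤ p.1 ∧ 0 ≤ p.2 ∧ p.1 + p.2 ≤ 1} := by
    refine IsClosed.measurableSet ?_
    exact (isClosed_le continuous_const continuous_fst).inter
      ((isClosed_le continuous_const continuous_snd).inter
        (isClosed_le (continuous_fst.add continuous_snd) continuous_const))
  have hs : ∀ x : ℝ, MeasureTheory.volume
      (Prod.mk x ⁻¹' {p : ℝ × ℝ | 0 ≤ p.1 ∧ 0 ≤ p.2 ∧ p.1 + p.2 ≤ 1}) =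
        (Set.Icc (0 : ℝ) 1).indicator (fun x => ENNReal.ofReal (1 - x)) x := by
    intro x
    by_cases hx : x ∈ Set.Icc (0 : ℝ) 1
    · rw [Set.indicator_of_mem hx]
      rw [show Prod.mk x ⁻¹' {p : ℝ × ℝ | 0 ≤ p.1 ∧ 0 ≤ p.2 ∧ p.1 + p.2 ≤ 1} =
        Set.Icc 0 (1 - x) from ?_, Real.volume_Icc, sub_zero]
      ext y
      simp only [Set.mem_preimage, Set.mem_ofPred_eq, Set.mem_Icc]
      exact ⟨fun h => ⟨h.2.1, by linarith [h.2.2]⟩, fun h => ⟨hx.1, h.1, by linarith [h.2]⟩⟩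
    · rw [Set.indicator_of_notMem hx]
      rw [show Prod.mk x ⁻¹' {p : ℝ × ℝ | 0 ≤ p.1 ∧ 0 ≤ p.2 ∧ p.1 + p.2 ≤ 1} = ∅ from ?_,
        MeasureTheory.measure_empty]
      ext y
      simp only [Set.mem_preimage, Set.mem_ofPred_eq, Set.mem_empty_iff_false, iff_false]
      rintro ⟨h1, h2, h3⟩
      exact hx ⟨h1, by linarith⟩
  rw [MeasureTheory.Measure.volume_eq_prod, MeasureTheory.Measure.prod_apply hm]
  simp_rw [hs]
  rw [MeasureTheory.lintegral_indicator measurableSet_Icc,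
    ← MeasureTheory.ofReal_integral_eq_lintegral_ofReal]
  · congr 1
    rw [MeasureTheory.integral_Icc_eq_integral_Ioc, ← intervalIntegral.integral_of_le zero_le_one,
      intervalIntegral.integral_sub (by simp) (by simp)]
    norm_num
  · exact (continuous_const.sub continuous_id).integrableOn_Icc
  · filter_upwards [MeasureTheory.ae_restrict_mem measurableSet_Icc] with x hx
    simpa using hx.2

/-- The triangle is an affine image of the standard triangle, and `doubleArea f` is the determinant
of the linear part. -/
theorem volume_convexHull_triple (f : Fin 3 → ℝ × ℝ) :
    MeasureTheory.volume (convexHull ℝ (Set.range f)) = ENNReal.ofReal (|doubleArea f| / 2) := by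
  let A : ℝ × ℝ →ₗ[ℝ] ℝ × ℝ := Matrix.toLin (Module.Basis.finTwoProd ℝ) (Module.Basis.finTwoProd ℝ)
    !![(f 1).1 - (f 0).1, (f 2).1 - (f 0).1; (f 1).2 - (f 0).2, (f 2).2 - (f 0).2]
  have hA : ∀ p q, A (p, q) = (((f 1).1 - (f 0).1) * p + ((f 2).1 - (f 0).1) * q,
      ((f 1).2 - (f 0).2) * p + ((f 2).2 - (f 0).2) * q) := by
    intro p q
    simp [A, Matrix.toLin_finTwoProd_apply]
  have hdet : LinearMap.det A = doubleArea f := by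
    simp only [A, LinearMap.det_toLin, Matrix.det_fin_two_of, doubleArea]
    ring
  have hr : Set.range f = (fun p => f 0 + p) ''
      (A '' Set.range ![((0 : ℝ), (0 : ℝ)), (1, 0), (0, 1)]) := by
    rw [← Set.range_comp, ← Set.range_comp]
    congr 1
    funext i
    fin_cases i <;> ext <;> simp [hA]
  have h2 : convexHull ℝ (Set.range f) = (fun p => f 0 + p) ''
      (A '' {p : ℝ × ℝ | 0 ≤ p.1 ∧ 0 ≤ p.2 ∧ p.1 + p.2 ≤ 1}) := by
    rw [hr, ← convexHull_standard_triangle, LinearMap.image_convexHull]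
    exact convexHull_vadd (𝕜 := ℝ) (f 0) _
  rw [h2, Set.image_add_left, MeasureTheory.measure_preimage_add,
    MeasureTheory.Measure.addHaar_image_linearMap, volume_standard_triangle, hdet,
    ← ENNReal.ofReal_mul (abs_nonneg _)]
  congr 1
  ring

theorem affineIndependent_of_doubleArea_ne_zero (f : Fin 3 → ℝ × ℝ) (h : doubleArea f ≠ 0) :
    AffineIndependent ℝ f := by
  rw [affineIndependent_iff_of_fintype]
  intro w hw hs
  rw [Finset.weightedVSub_eq_linear_combination Finset.univ hw] at hs
  simp only [Fin.sum_univ_three] at hw hs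
  have e₁ := congrArg Prod.fst hs
  have e₂ := congrArg Prod.snd hs
  simp only [Prod.fst_add, Prod.snd_add, Prod.smul_fst, Prod.smul_snd, smul_eq_mul, Prod.fst_zero,
    Prod.snd_zero] at e₁ e₂
  -- Eliminating `w 0` leaves a 2 × 2 system with determinant `doubleArea f`; this is Cramer's rule.
  have h₁ : w 1 = 0 := by
    refine (mul_eq_zero.mp ?_).resolve_right h
    unfold doubleArea
    linear_combination ((f 2).2 - (f 0).2) * e₁ - ((f 2).1 - (f 0).1) * e₂ +
      ((f 2).1 * (f 0).2 - (f 2).2 * (f 0).1) * hw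
  have h₂ : w 2 = 0 := by
    refine (mul_eq_zero.mp ?_).resolve_right h
    unfold doubleArea
    linear_combination -((f 1).2 - (f 0).2) * e₁ + ((f 1).1 - (f 0).1) * e₂ -
      ((f 1).1 * (f 0).2 - (f 1).2 * (f 0).1) * hw
  intro i
  fin_cases i
  · simp only [h₁, h₂, add_zero] at hw
    exact hw
  · exact h₁
  · exact h₂

/-- Sets that cover a region of finite measure and whose measures add up to the measure of the
region have disjoint interiors. -/
theorem disjoint_interior_of_cover {ι : Type*} [Fintype ι] (T : ι → Set (ℝ × ℝ))
    (S : Set (ℝ × ℝ)) (hcov : ⋃ i, T i = S) (hS : MeasureTheory.volume S ≠ ⊤)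
    (hsum : ∑ i, MeasureTheory.volume (T i) = MeasureTheory.volume S) (i j : ι) (hij : i ≠ j) :
    Disjoint (interior (T i)) (interior (T j)) := by
  classical
  by_contra hne
  rw [Set.not_disjoint_iff_nonempty_inter] at hne
  set O := interior (T i) ∩ interior (T j) with hO
  have hopen : IsOpen O := isOpen_interior.inter isOpen_interior
  have hpos : 0 < MeasureTheory.volume O := hopen.measure_pos _ hne
  have hOi : O ⊆ T i := Set.inter_subset_left.trans interior_subset
  have hOj : O ⊆ T j := Set.inter_subset_right.trans interior_subset
  have hfin : ∀ l, MeasureTheory.volume (T l) ≠ ⊤ := fun l =>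
    ne_top_of_le_ne_top hS (MeasureTheory.measure_mono (hcov ▸ Set.subset_iUnion T l))
  have hO' : MeasureTheory.volume O ≠ ⊤ :=
    ne_top_of_le_ne_top (hfin i) (MeasureTheory.measure_mono hOi)
  -- As `O` also lies in `T j`, it can be removed from `T i` without losing the covering. The
  -- remaining measures then add up to less than the measure of `S`.
  have hle : MeasureTheory.volume S ≤ MeasureTheory.volume (T i \ O) +
      ∑ l ∈ Finset.univ.erase i, MeasureTheory.volume (T l) := by
    have : S ⊆ (T i \ O) ∪ ⋃ l ∈ Finset.univ.erase i, T l := by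
      rw [← hcov]
      refine Set.iUnion_subset fun l z hz => ?_
      by_cases hl : l = i
      · subst hl
        by_cases hzO : z ∈ O
        · exact Or.inr (Set.mem_biUnion (x := j) (by simp [hij.symm]) (hOj hzO))
        · exact Or.inl ⟨hz, hzO⟩
      · exact Or.inr (Set.mem_biUnion (x := l) (by simp [hl]) hz)
    refine (MeasureTheory.measure_mono this).trans ((MeasureTheory.measure_union_le _ _).trans ?_)
    gcongr
    exact MeasureTheory.measure_biUnion_finset_le _ _
  have hlt : MeasureTheory.volume (T i \ O) < MeasureTheory.volume (T i) := by
    rw [MeasureTheory.measure_sdiff hOi hopen.measurableSet.nullMeasurableSet hO']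
    exact ENNReal.sub_lt_self (hfin i)
      (hpos.trans_le (MeasureTheory.measure_mono hOi)).ne' hpos.ne'
  have : MeasureTheory.volume S < MeasureTheory.volume S := by
    refine hle.trans_lt ?_
    rw [← hsum, ← Finset.add_sum_erase _ _ (Finset.mem_univ i)]
    exact ENNReal.add_lt_add_right (ENNReal.sum_ne_top.mpr fun l _ => hfin l) hlt
  exact lt_irrefl _ this

/-! ### The products of step ratios -/

/-- The factor by which the distance of a node from the apex shrinks at the `i`-th step, so that
the product of the two distances decreases from `1 - (i - 1) x` to `1 - i x`. -/
noncomputable def stepRatio (x : ℝ) (i : ℕ) : ℝ := (1 - i * x) / (1 - (i - 1) * x)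

noncomputable def plusProd (x : ℝ) (i : ℕ) : ℝ :=
  ∏ t ∈ Finset.Icc 1 i, if thueMorse t = 1 then stepRatio x t else 1

noncomputable def minusProd (x : ℝ) (i : ℕ) : ℝ :=
  ∏ t ∈ Finset.Icc 1 i, if thueMorse t = -1 then stepRatio x t else 1

theorem plusProd_succ (x : ℝ) (i : ℕ) :
    plusProd x (i + 1) = plusProd x i * if thueMorse (i + 1) = 1 then stepRatio x (i + 1) else 1 :=
  Finset.prod_Icc_succ_top (by omega) _

theorem minusProd_succ (x : ℝ) (i : ℕ) :
    minusProd x (i + 1) =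
      minusProd x i * if thueMorse (i + 1) = -1 then stepRatio x (i + 1) else 1 :=
  Finset.prod_Icc_succ_top (by omega) _

@[simp] theorem plusProd_zero (x : ℝ) : plusProd x 0 = 1 := by simp [plusProd]

@[simp] theorem minusProd_zero (x : ℝ) : minusProd x 0 = 1 := by simp [minusProd]

section

variable {x : ℝ} (hx : 0 < x)

include hx

theorem mul_lt_one_of_le {i j : ℕ} (hij : i ≤ j) (hj : j * x < 1) : i * x < 1 := by
  have : (i : ℝ) ≤ j := by exact_mod_cast hij
  nlinarith

theorem stepRatio_pos {i : ℕ} (hi : i * x < 1) : 0 < stepRatio x i :=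
  div_pos (by linarith) (by linarith)

theorem stepRatio_lt_one {i : ℕ} (hi : i * x < 1) : stepRatio x i < 1 := by
  rw [stepRatio, div_lt_one (by linarith)]
  linarith

theorem stepRatio_succ_le {i : ℕ} (hi : (i + 1 : ℕ) * x < 1) :
    stepRatio x (i + 1) ≤ stepRatio x i := by
  push_cast at hi
  rw [stepRatio, stepRatio, div_le_div_iff₀ (by push_cast; linarith) (by linarith)]
  push_cast
  nlinarith [sq_nonneg x]

theorem plusProd_pos {i : ℕ} (hi : i * x < 1) : 0 < plusProd x i := by
  refine Finset.prod_pos fun t ht => ?_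
  split_ifs
  · exact stepRatio_pos hx (mul_lt_one_of_le hx (Finset.mem_Icc.mp ht).2 hi)
  · exact one_pos

theorem minusProd_pos {i : ℕ} (hi : i * x < 1) : 0 < minusProd x i := by
  refine Finset.prod_pos fun t ht => ?_
  split_ifs
  · exact stepRatio_pos hx (mul_lt_one_of_le hx (Finset.mem_Icc.mp ht).2 hi)
  · exact one_pos

theorem plusProd_le_one {i : ℕ} (hi : i * x < 1) : plusProd x i ≤ 1 := by
  refine Finset.prod_le_one (fun t ht => ?_) fun t ht => ?_ <;> split_ifs
  · exact (stepRatio_pos hx (mul_lt_one_of_le hx (Finset.mem_Icc.mp ht).2 hi)).le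
  · exact zero_le_one
  · exact (stepRatio_lt_one hx (mul_lt_one_of_le hx (Finset.mem_Icc.mp ht).2 hi)).le
  · exact le_rfl

theorem minusProd_le_one {i : ℕ} (hi : i * x < 1) : minusProd x i ≤ 1 := by
  refine Finset.prod_le_one (fun t ht => ?_) fun t ht => ?_ <;> split_ifs
  · exact (stepRatio_pos hx (mul_lt_one_of_le hx (Finset.mem_Icc.mp ht).2 hi)).le
  · exact zero_le_one
  · exact (stepRatio_lt_one hx (mul_lt_one_of_le hx (Finset.mem_Icc.mp ht).2 hi)).le
  · exact le_rfl

theorem plusProd_mul_minusProd {i : ℕ} (hi : i * x < 1) :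
    plusProd x i * minusProd x i = 1 - i * x := by
  induction i with
  | zero => simp
  | succ i ih =>
    have hi' := mul_lt_one_of_le hx (Nat.le_succ i) hi
    have e : plusProd x (i + 1) * minusProd x (i + 1) =
        plusProd x i * minusProd x i * stepRatio x (i + 1) := by
      rw [plusProd_succ, minusProd_succ]
      rcases thueMorse_eq_one_or_neg_one (i + 1) (by omega) with h | h <;> simp [h] <;> ring
    rw [e, ih hi', stepRatio]
    push_cast
    rw [add_sub_cancel_right, mul_div_cancel₀ _ (by linarith)]

/-- The two products stay balanced: each new pair of ratios gives one to either product, and the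
ratios decrease. The bound is symmetric in the two products because the order of the signs within a
pair is arbitrary; the extra ratio on the left makes the induction close for both orders. -/
theorem plusProd_le_minusProd {l : ℕ} (hl : (2 * l + 1 : ℕ) * x < 1) :
    plusProd x (2 * l) * stepRatio x (2 * l + 1) ≤ stepRatio x 1 * minusProd x (2 * l) ∧
      minusProd x (2 * l) * stepRatio x (2 * l + 1) ≤ stepRatio x 1 * plusProd x (2 * l) := by
  induction l with
  | zero => simp
  | succ l ih =>
    have h2 : (2 * l + 2 : ℕ) * x < 1 := mul_lt_one_of_le hx (by omega) hl
    have h1 : (2 * l + 1 : ℕ) * x < 1 := mul_lt_one_of_le hx (by omega) hl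
    obtain ⟨ih₁, ih₂⟩ := ih h1
    have d₁ : stepRatio x (2 * l + 2) ≤ stepRatio x (2 * l + 1) := stepRatio_succ_le hx h2
    have d₂ : stepRatio x (2 * l + 3) ≤ stepRatio x (2 * l + 2) := stepRatio_succ_le hx hl
    have p₀ := stepRatio_pos hx (i := 1) (mul_lt_one_of_le hx (by omega) hl)
    have p₁ := stepRatio_pos hx h1
    have p₂ := stepRatio_pos hx h2
    have p₃ : 0 < stepRatio x (2 * l + 3) := stepRatio_pos hx hl
    have q₁ := plusProd_pos hx (i := 2 * l) (mul_lt_one_of_le hx (by omega) hl)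
    have q₂ := minusProd_pos hx (i := 2 * l) (mul_lt_one_of_le hx (by omega) hl)
    have aux : ∀ {P Q A B C D : ℝ}, 0 < P → 0 < Q → 0 < A → 0 < B → 0 < D → C ≤ B → B ≤ A →
        P * A ≤ D * Q → P * A * C ≤ D * (Q * B) ∧ P * B * C ≤ D * (Q * A) := by
      intro P Q A B C D hP hQ hA hB hD hCB hBA h
      constructor
      · calc P * A * C ≤ P * A * B := by gcongr
          _ ≤ D * Q * B := by gcongr
          _ = _ := by ring
      · calc P * B * C ≤ P * B * B := by gcongr
          _ ≤ P * A * A := by gcongr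
          _ ≤ D * Q * A := by gcongr
          _ = _ := by ring
    have a₁ := aux q₁ q₂ p₁ p₂ p₀ d₂ d₁ ih₁
    have a₂ := aux q₂ q₁ p₁ p₂ p₀ d₂ d₁ ih₂
    rw [show 2 * (l + 1) = 2 * l + 1 + 1 by ring, plusProd_succ, minusProd_succ, plusProd_succ,
      minusProd_succ, show 2 * l + 1 + 1 = 2 * l + 2 by ring, thueMorse_two_mul_add_two]
    rcases thueMorse_eq_one_or_neg_one (2 * l + 1) (by omega) with h | h
    · simpa [h] using ⟨a₁.1, a₂.2⟩
    · simpa [h] using ⟨a₁.2, a₂.1⟩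

/-- The signed sum is the logarithm of the quotient of the products. On `(0, 1]` the logarithm has
slope at least `1`, so it does not shrink distances. -/
theorem abs_plusProd_sub_minusProd_le {i : ℕ} (hi : i * x < 1) :
    |plusProd x i - minusProd x i| ≤
      |∑ t ∈ Finset.Icc 1 i, (thueMorse t : ℝ) *
        (Real.log (1 - t * x) - Real.log (1 - (t - 1) * x))| := by
  have hpos : ∀ t ∈ Finset.Icc 1 i, 0 < stepRatio x t := fun t ht =>
    stepRatio_pos hx (mul_lt_one_of_le hx (Finset.mem_Icc.mp ht).2 hi)
  have e : ∑ t ∈ Finset.Icc 1 i, (thueMorse t : ℝ) *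
      (Real.log (1 - t * x) - Real.log (1 - (t - 1) * x)) =
      Real.log (plusProd x i) - Real.log (minusProd x i) := by
    rw [plusProd, minusProd, Real.log_prod, Real.log_prod, ← Finset.sum_sub_distrib]
    · refine Finset.sum_congr rfl fun t ht => ?_
      have ht' := mul_lt_one_of_le hx (Finset.mem_Icc.mp ht).2 hi
      have : Real.log (stepRatio x t) = Real.log (1 - t * x) - Real.log (1 - (t - 1) * x) := by
        rw [stepRatio, Real.log_div (by linarith) (by linarith)]
      rcases thueMorse_eq_one_or_neg_one t (Finset.mem_Icc.mp ht).1 with h | h <;>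
        simp [h, this]
    · intro t ht
      split_ifs
      · exact (hpos t ht).ne'
      · exact one_ne_zero
    · intro t ht
      split_ifs
      · exact (hpos t ht).ne'
      · exact one_ne_zero
  have aux : ∀ a b : ℝ, 0 < a → 0 < b → b ≤ 1 → b - a ≤ |Real.log a - Real.log b| := by
    intro a b ha hb hb1
    rcases le_total b a with h | h
    · linarith [abs_nonneg (Real.log a - Real.log b)]
    · have h1 := Real.log_le_sub_one_of_pos (div_pos ha hb)
      rw [Real.log_div ha.ne' hb.ne'] at h1
      have h2 : b - a ≤ 1 - a / b := by
        rw [show 1 - a / b = (b - a) / b by field_simp, le_div_iff₀ hb]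
        nlinarith
      linarith [neg_abs_le (Real.log a - Real.log b)]
  rw [e, abs_le']
  have hp := plusProd_pos hx hi
  have hm := minusProd_pos hx hi
  constructor
  · rw [abs_sub_comm]
    exact aux _ _ hm hp (plusProd_le_one hx hi)
  · rw [neg_sub]
    exact aux _ _ hp hm (minusProd_le_one hx hi)

end

/-! ### Nodes and areas in the strip -/

/-- The relative distances from the apex of the nodes on the slanted line. -/
noncomputable def slantPos (M : ℕ) (x ρ : ℝ) (j : ℕ) : ℝ :=
  if j < M then plusProd x (2 * j) else ρ

/-- The relative distances from the apex of the nodes on the bottom side of the strip. -/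
noncomputable def bottomPos (M : ℕ) (x ρ : ℝ) (j : ℕ) : ℝ :=
  if j < M then minusProd x (2 * j) else ρ

/-- The assumptions on the parameters of the strip: it consists of `2 M` triangles, its left end
has relative size `1`, its right end relative size `ρ ^ 2`, and a triangle has relative size
`x`. -/
structure StripParams (M : ℕ) (x ρ : ℝ) : Prop where
  one_le : 1 ≤ M
  x_pos : 0 < x
  rho_pos : 0 < ρ
  rho_sq : ρ ^ 2 = 1 - (2 * M : ℕ) * x

namespace StripParams

variable {M : ℕ} {x ρ : ℝ} (h : StripParams M x ρ)

include h

theorem mul_lt_one {i : ℕ} (hi : i ≤ 2 * M) : i * x < 1 :=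
  mul_lt_one_of_le h.x_pos hi (by have := h.rho_sq; have := pow_pos h.rho_pos 2; linarith)

theorem slantPos_zero : slantPos M x ρ 0 = 1 := by simp [slantPos, Nat.lt_of_succ_le h.one_le]

theorem bottomPos_zero : bottomPos M x ρ 0 = 1 := by simp [bottomPos, Nat.lt_of_succ_le h.one_le]

theorem slantPos_pos {j : ℕ} : 0 < slantPos M x ρ j := by
  rw [slantPos]
  split_ifs
  · exact plusProd_pos h.x_pos (h.mul_lt_one (by omega))
  · exact h.rho_pos

theorem bottomPos_pos {j : ℕ} : 0 < bottomPos M x ρ j := by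
  rw [bottomPos]
  split_ifs
  · exact minusProd_pos h.x_pos (h.mul_lt_one (by omega))
  · exact h.rho_pos

/-- The last node must lie beyond its predecessor although it was moved to `ρ`. With `P`, `Q` the
two products after `2 l` steps, balance bounds `P * Q * stepRatio x (2 * l + 1)`, which is `1 - (2 l
+ 1) x`, by `(1 - x) * Q ^ 2`. It exceeds `(1 - x) * ρ ^ 2`, so `ρ < Q`. -/
theorem rho_lt {l : ℕ} (hl : l + 1 = M) :
    ρ < plusProd x (2 * l) ∧ ρ < minusProd x (2 * l) := by
  have hx := h.x_pos
  obtain ⟨b₁, b₂⟩ := plusProd_le_minusProd hx (l := l) (h.mul_lt_one (by omega))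
  have hp := plusProd_pos hx (i := 2 * l) (h.mul_lt_one (by omega))
  have hm := minusProd_pos hx (i := 2 * l) (h.mul_lt_one (by omega))
  have hpm := plusProd_mul_minusProd hx (i := 2 * l) (h.mul_lt_one (by omega))
  have hs := h.rho_sq
  have hρ := h.rho_pos
  rw [← hl] at hs
  push_cast at hpm hs
  have hρ2 : 0 < ρ ^ 2 := by positivity
  have key : stepRatio x 1 * ρ ^ 2 < stepRatio x (2 * l + 1) * (1 - 2 * l * x) := by
    simp only [stepRatio]
    push_cast
    rw [sub_self, zero_mul, sub_zero, div_one, add_sub_cancel_right,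
      div_mul_cancel₀ _ (by nlinarith), hs, one_mul]
    have : (0 : ℝ) ≤ l := Nat.cast_nonneg l
    nlinarith
  have r₁ : 0 < stepRatio x 1 := stepRatio_pos hx (by simpa using h.mul_lt_one (i := 1) (by omega))
  have aux : ∀ {P Q : ℝ}, 0 < P → 0 < Q → P * Q = 1 - 2 * l * x →
      P * stepRatio x (2 * l + 1) ≤ stepRatio x 1 * Q → ρ < Q := by
    intro P Q hP hQ hPQ hle
    refine lt_of_pow_lt_pow_left₀ 2 hQ.le ?_
    refine lt_of_mul_lt_mul_left (a := stepRatio x 1) ?_ r₁.le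
    calc stepRatio x 1 * ρ ^ 2 < stepRatio x (2 * l + 1) * (1 - 2 * l * x) := key
      _ = P * stepRatio x (2 * l + 1) * Q := by rw [← hPQ]; ring
      _ ≤ stepRatio x 1 * Q * Q := by gcongr
      _ = _ := by ring
  exact ⟨aux hm hp (by rw [mul_comm, hpm]) b₂, aux hp hm hpm b₁⟩

theorem slantPos_succ_lt {j : ℕ} (hj : j < M) : slantPos M x ρ (j + 1) < slantPos M x ρ j := by
  rw [slantPos, slantPos, if_pos hj]
  split_ifs with h'
  · have hp := plusProd_pos h.x_pos (i := 2 * j) (h.mul_lt_one (by omega))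
    rw [show 2 * (j + 1) = 2 * j + 1 + 1 by ring, plusProd_succ, plusProd_succ,
      show 2 * j + 1 + 1 = 2 * j + 2 by ring, thueMorse_two_mul_add_two]
    have s₁ := stepRatio_lt_one h.x_pos (i := 2 * j + 1) (h.mul_lt_one (by omega))
    have s₂ := stepRatio_lt_one h.x_pos (i := 2 * j + 2) (h.mul_lt_one (by omega))
    rcases thueMorse_eq_one_or_neg_one (2 * j + 1) (by omega) with e | e <;> simp [e] <;>
      exact mul_lt_of_lt_one_right hp (by assumption)
  · exact (h.rho_lt (by omega)).1

theorem bottomPos_succ_lt {j : ℕ} (hj : j < M) :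
    bottomPos M x ρ (j + 1) < bottomPos M x ρ j := by
  rw [bottomPos, bottomPos, if_pos hj]
  split_ifs with h'
  · have hp := minusProd_pos h.x_pos (i := 2 * j) (h.mul_lt_one (by omega))
    rw [show 2 * (j + 1) = 2 * j + 1 + 1 by ring, minusProd_succ, minusProd_succ,
      show 2 * j + 1 + 1 = 2 * j + 2 by ring, thueMorse_two_mul_add_two]
    have s₁ := stepRatio_lt_one h.x_pos (i := 2 * j + 1) (h.mul_lt_one (by omega))
    have s₂ := stepRatio_lt_one h.x_pos (i := 2 * j + 2) (h.mul_lt_one (by omega))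
    rcases thueMorse_eq_one_or_neg_one (2 * j + 1) (by omega) with e | e <;> simp [e] <;>
      exact mul_lt_of_lt_one_right hp (by assumption)
  · exact (h.rho_lt (by omega)).2

-- Among the first `2 j` signs exactly `j` are positive, so the node with index `j` has position
-- `plusProd x (2 * j)`, whichever step of the `j`-th pair placed it. The bound on `i` keeps the
-- modified last node out.
omit h in
theorem slantPos_plusCount {i : ℕ} (hi : i + 2 ≤ 2 * M) :
    slantPos M x ρ (plusCount i) = plusProd x i := by
  rcases Nat.even_or_odd' i with ⟨l, rfl | rfl⟩
  · rw [plusCount_two_mul, slantPos, if_pos (by omega)]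
  · rw [plusCount_succ, plusCount_two_mul]
    rcases thueMorse_eq_one_or_neg_one (2 * l + 1) (by omega) with e | e
    · rw [if_pos e, slantPos, if_pos (by omega), show 2 * (l + 1) = 2 * l + 1 + 1 by ring,
        plusProd_succ, show 2 * l + 1 + 1 = 2 * l + 2 by ring, thueMorse_two_mul_add_two]
      simp [e]
    · rw [slantPos, if_pos (by split_ifs <;> omega), plusProd_succ]
      simp [e]

omit h in
theorem bottomPos_minusCount {i : ℕ} (hi : i + 2 ≤ 2 * M) :
    bottomPos M x ρ (minusCount i) = minusProd x i := by
  rcases Nat.even_or_odd' i with ⟨l, rfl | rfl⟩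
  · rw [minusCount_two_mul, bottomPos, if_pos (by omega)]
  · rw [minusCount_succ, minusCount_two_mul]
    rcases thueMorse_eq_one_or_neg_one (2 * l + 1) (by omega) with e | e
    · rw [bottomPos, if_pos (by split_ifs <;> omega), minusProd_succ]
      simp [e]
    · rw [if_pos e, bottomPos, if_pos (by omega), show 2 * (l + 1) = 2 * l + 1 + 1 by ring,
        minusProd_succ, show 2 * l + 1 + 1 = 2 * l + 2 by ring, thueMorse_two_mul_add_two]
      simp [e]

end StripParams

/-- The relative size of what is left of the triangle after `i` triangles have been cut off. -/
noncomputable def restArea (M : ℕ) (x ρ : ℝ) (i : ℕ) : ℝ :=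
  slantPos M x ρ (plusCount i) * bottomPos M x ρ (minusCount i)

namespace StripParams

variable {M : ℕ} {x ρ : ℝ} (h : StripParams M x ρ)

include h

/-- At `i = 2 * M` both nodes are at `ρ`, and `ρ ^ 2` is the exact value. Only at `i = 2 * M - 1` is
exactly one of the two nodes a moved one. -/
theorem restArea_eq {i : ℕ} (hi : i ≤ 2 * M) (hne : i + 1 ≠ 2 * M) :
    restArea M x ρ i = 1 - i * x := by
  rcases eq_or_ne i (2 * M) with rfl | hi'
  · rw [restArea, plusCount_two_mul, minusCount_two_mul, slantPos, bottomPos,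
      if_neg (lt_irrefl _), if_neg (lt_irrefl _), ← sq, h.rho_sq]
  · rw [restArea, slantPos_plusCount (by omega), bottomPos_minusCount (by omega),
      plusProd_mul_minusProd h.x_pos (h.mul_lt_one hi)]

/-- `ρ` is the geometric mean of the two products. -/
theorem abs_sub_rho_le :
    |plusProd x (2 * M) - ρ| ≤ |plusProd x (2 * M) - minusProd x (2 * M)| ∧
      |minusProd x (2 * M) - ρ| ≤ |plusProd x (2 * M) - minusProd x (2 * M)| := by
  have hx := h.x_pos
  have hp := plusProd_pos hx (h.mul_lt_one le_rfl)
  have hm := minusProd_pos hx (h.mul_lt_one le_rfl)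
  have hpm := plusProd_mul_minusProd hx (h.mul_lt_one le_rfl)
  rw [← h.rho_sq] at hpm
  have hρ := h.rho_pos
  generalize plusProd x (2 * M) = p at *
  generalize minusProd x (2 * M) = q at *
  rcases le_total p q with hpq | hpq
  · have h1 : p ≤ ρ := by by_contra! hc; nlinarith
    have h2 : ρ ≤ q := by by_contra! hc; nlinarith
    rw [abs_of_nonpos (by linarith : p - ρ ≤ 0), abs_of_nonneg (by linarith : 0 ≤ q - ρ),
      abs_of_nonpos (by linarith : p - q ≤ 0)]
    constructor <;> linarith
  · have h1 : q ≤ ρ := by by_contra! hc; nlinarith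
    have h2 : ρ ≤ p := by by_contra! hc; nlinarith
    rw [abs_of_nonneg (by linarith : 0 ≤ p - ρ), abs_of_nonpos (by linarith : q - ρ ≤ 0),
      abs_of_nonneg (by linarith : 0 ≤ p - q)]
    constructor <;> linarith

/-- At the exceptional index one factor is `ρ` instead of the final product, and the other factor is
at most `1`. -/
theorem abs_restArea_sub_le {i : ℕ} (hi : i ≤ 2 * M) :
    |restArea M x ρ i - (1 - i * x)| ≤ |plusProd x (2 * M) - minusProd x (2 * M)| := by
  by_cases hne : i + 1 = 2 * M
  · obtain ⟨l, hl⟩ : ∃ l, M = l + 1 := ⟨M - 1, by have := h.one_le; omega⟩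
    obtain rfl : i = 2 * l + 1 := by omega
    have hx := h.x_pos
    obtain ⟨a₁, a₂⟩ := h.abs_sub_rho_le
    have hpm := plusProd_mul_minusProd hx (h.mul_lt_one hi)
    have eM : 2 * M = 2 * l + 1 + 1 := by omega
    have htm := thueMorse_two_mul_add_two l
    have hm := minusProd_pos hx (i := 2 * l) (h.mul_lt_one (by omega))
    have hm1 := minusProd_le_one hx (i := 2 * l) (h.mul_lt_one (by omega))
    have hp := plusProd_pos hx (i := 2 * l) (h.mul_lt_one (by omega))
    have hp1 := plusProd_le_one hx (i := 2 * l) (h.mul_lt_one (by omega))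
    rw [← hpm]
    rcases thueMorse_eq_one_or_neg_one (2 * l + 1) (by omega) with e | e
    · have eq : restArea M x ρ (2 * l + 1) = ρ * minusProd x (2 * l) := by
        simp [restArea, plusCount_succ, minusCount_succ, plusCount_two_mul, minusCount_two_mul, e,
          slantPos, bottomPos, hl]
      have e₁ : plusProd x (2 * l + 1) = plusProd x (2 * M) := by
        rw [eM, plusProd_succ x (2 * l + 1), show 2 * l + 1 + 1 = 2 * l + 2 by ring, htm]
        simp [e]
      have e₂ : minusProd x (2 * l + 1) = minusProd x (2 * l) := by
        rw [minusProd_succ]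
        simp [e]
      rw [eq, e₁, e₂, ← sub_mul, abs_mul, abs_of_pos hm, abs_sub_comm]
      exact (mul_le_of_le_one_right (abs_nonneg _) hm1).trans a₁
    · have eq : restArea M x ρ (2 * l + 1) = plusProd x (2 * l) * ρ := by
        simp [restArea, plusCount_succ, minusCount_succ, plusCount_two_mul, minusCount_two_mul, e,
          slantPos, bottomPos, hl]
      have e₁ : minusProd x (2 * l + 1) = minusProd x (2 * M) := by
        rw [eM, minusProd_succ x (2 * l + 1), show 2 * l + 1 + 1 = 2 * l + 2 by ring, htm]
        simp [e]
      have e₂ : plusProd x (2 * l + 1) = plusProd x (2 * l) := by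
        rw [plusProd_succ]
        simp [e]
      rw [eq, e₁, e₂, ← mul_sub, abs_mul, abs_of_pos hp, abs_sub_comm]
      exact (mul_le_of_le_one_left (abs_nonneg _) hp1).trans a₂
  · rw [h.restArea_eq hi hne, sub_self, abs_zero]
    exact abs_nonneg _

end StripParams

namespace StripParams

variable {M : ℕ} {x ρ : ℝ} (h : StripParams M x ρ)

include h

theorem slantPos_lt {i j : ℕ} (hij : i < j) (hj : j ≤ M) : slantPos M x ρ j < slantPos M x ρ i := by
  induction j, hij using Nat.le_induction with
  | base => exact h.slantPos_succ_lt (by omega)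
  | succ j hij ih => exact (h.slantPos_succ_lt (by omega)).trans (ih (by omega))

theorem bottomPos_lt {i j : ℕ} (hij : i < j) (hj : j ≤ M) :
    bottomPos M x ρ j < bottomPos M x ρ i := by
  induction j, hij using Nat.le_induction with
  | base => exact h.bottomPos_succ_lt (by omega)
  | succ j hij ih => exact (h.bottomPos_succ_lt (by omega)).trans (ih (by omega))

omit h in
theorem slantPos_of_le {j : ℕ} (hj : M ≤ j) : slantPos M x ρ j = ρ := by
  simp [slantPos, hj]

omit h in
theorem bottomPos_of_le {j : ℕ} (hj : M ≤ j) : bottomPos M x ρ j = ρ := by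
  simp [bottomPos, hj]

theorem rho_le_slantPos (j : ℕ) : ρ ≤ slantPos M x ρ j := by
  rcases Nat.lt_or_ge j M with hj | hj
  · exact (slantPos_of_le (x := x) le_rfl).symm.trans_le (h.slantPos_lt hj le_rfl).le
  · rw [slantPos_of_le hj]

theorem rho_le_bottomPos (j : ℕ) : ρ ≤ bottomPos M x ρ j := by
  rcases Nat.lt_or_ge j M with hj | hj
  · exact (bottomPos_of_le (x := x) le_rfl).symm.trans_le (h.bottomPos_lt hj le_rfl).le
  · rw [bottomPos_of_le hj]

theorem rho_lt_one : ρ < 1 := by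
  exact (slantPos_of_le (x := x) le_rfl).symm.trans_lt
    ((h.slantPos_lt h.one_le le_rfl).trans_eq h.slantPos_zero)

theorem slantPos_le_one (j : ℕ) : slantPos M x ρ j ≤ 1 := by
  rw [slantPos]
  split_ifs
  · exact plusProd_le_one h.x_pos (h.mul_lt_one (by omega))
  · exact h.rho_lt_one.le

theorem bottomPos_le_one (j : ℕ) : bottomPos M x ρ j ≤ 1 := by
  rw [bottomPos]
  split_ifs
  · exact minusProd_le_one h.x_pos (h.mul_lt_one (by omega))
  · exact h.rho_lt_one.le

omit h in
theorem plusCount_lt {i : ℕ} (hi : i < 2 * M) (hs : thueMorse (i + 1) = 1) : plusCount i < M := by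
  rcases Nat.even_or_odd' i with ⟨l, rfl | rfl⟩
  · rw [plusCount_two_mul]; omega
  · have := plusCount_succ (2 * l + 1)
    rw [if_pos hs, show 2 * l + 1 + 1 = 2 * (l + 1) by ring, plusCount_two_mul] at this
    omega

omit h in
theorem minusCount_lt {i : ℕ} (hi : i < 2 * M) (hs : thueMorse (i + 1) = -1) :
    minusCount i < M := by
  rcases Nat.even_or_odd' i with ⟨l, rfl | rfl⟩
  · rw [minusCount_two_mul]; omega
  · have := minusCount_succ (2 * l + 1)
    rw [if_pos hs, show 2 * l + 1 + 1 = 2 * (l + 1) by ring, minusCount_two_mul] at this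
    omega

theorem restArea_succ_lt {i : ℕ} (hi : i < 2 * M) : restArea M x ρ (i + 1) < restArea M x ρ i := by
  rw [restArea, restArea, plusCount_succ, minusCount_succ]
  rcases thueMorse_eq_one_or_neg_one (i + 1) (by omega) with e | e
  · rw [if_pos e, if_neg (by omega)]
    exact mul_lt_mul_of_pos_right (h.slantPos_succ_lt (plusCount_lt hi e)) h.bottomPos_pos
  · rw [if_neg (by omega), if_pos e]
    exact mul_lt_mul_of_pos_left (h.bottomPos_succ_lt (minusCount_lt hi e)) h.slantPos_pos

/-- The inexact value lies between two exact ones that differ by `2 * x`. This crude bound serves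
for small `n`. -/
theorem restArea_sub_le {i : ℕ} (hi : i < 2 * M) :
    restArea M x ρ i - restArea M x ρ (i + 1) ≤ 2 * x := by
  have hx := h.x_pos
  have e : ∀ j, j ≤ 2 * M → j + 1 ≠ 2 * M → restArea M x ρ j = 1 - j * x :=
    fun j h₁ h₂ => h.restArea_eq h₁ h₂
  by_cases h₁ : i + 1 = 2 * M
  · have h₂ := h.restArea_succ_lt (i := i - 1) (by omega)
    rw [e (i + 1) (by omega) (by omega)]
    rw [show i - 1 + 1 = i by omega, e (i - 1) (by omega) (by omega),
      Nat.cast_sub (by have := h.one_le; omega)] at h₂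
    push_cast at h₂ ⊢
    linarith
  · rw [e i (by omega) h₁]
    by_cases h₂ : i + 2 = 2 * M
    · have h₃ := h.restArea_succ_lt (i := i + 1) (by omega)
      rw [e (i + 1 + 1) (by omega) (by omega)] at h₃
      push_cast at h₃ ⊢
      linarith
    · rw [e (i + 1) (by omega) (by omega)]
      push_cast
      linarith

/-- At most one of the two consecutive values is inexact, so the error is not doubled. -/
theorem abs_restArea_sub_sub_le {i : ℕ} (hi : i < 2 * M) :
    |restArea M x ρ i - restArea M x ρ (i + 1) - x| ≤
      |plusProd x (2 * M) - minusProd x (2 * M)| := by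
  by_cases h₁ : i + 1 = 2 * M
  · have := h.abs_restArea_sub_le hi.le
    rw [h.restArea_eq (i := i + 1) (by omega) (by omega)]
    convert this using 2
    push_cast
    ring
  · have := h.abs_restArea_sub_le (i := i + 1) hi
    rw [h.restArea_eq (i := i) (by omega) h₁]
    rw [abs_sub_comm] at this
    convert this using 2
    push_cast
    ring

end StripParams

/-! ### Placement of the nodes in the square -/

/-- Metric data of the placement of a dissection with `2 M` triangles in the strip and `m` pairs
of triangles to its right: the strip has width `w`, the line through the slanted nodes meets the
bottom line at distance `L` from the left side, and consecutive nodes to the right of the strip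
have distance `g`. -/
structure PlacementData where
  M : ℕ
  m : ℕ
  x : ℝ
  ρ : ℝ
  L : ℝ
  w : ℝ
  g : ℝ
  strip : StripParams M x ρ
  L_pos : 0 < L
  g_pos : 0 < g
  L_mul_one_sub : L * (1 - ρ) = w
  L_mul_x : L * x = g
  w_add : w + m * g = 1
  w_mul_one_sub : w * (1 - ρ) = g

namespace PlacementData

variable (p : PlacementData)

noncomputable def place : StripNode → ℝ × ℝ
  | .slant j => (p.L * (1 - slantPos p.M p.x p.ρ j), slantPos p.M p.x p.ρ j)
  | .bottom j =>
      if j ≤ p.M then (p.L * (1 - bottomPos p.M p.x p.ρ j), 0)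
      else (p.w + (j - p.M : ℕ) * p.g, 0)
  | .top j => (p.w + j * p.g, 1)

theorem place_slant (j : ℕ) : p.place (.slant j) =
    (p.L * (1 - slantPos p.M p.x p.ρ j), slantPos p.M p.x p.ρ j) := rfl

theorem place_bottom_of_le {j : ℕ} (hj : j ≤ p.M) : p.place (.bottom j) =
    (p.L * (1 - bottomPos p.M p.x p.ρ j), 0) := if_pos hj

theorem place_bottom_add (j : ℕ) : p.place (.bottom (p.M + j)) = (p.w + j * p.g, 0) := by
  rcases Nat.eq_zero_or_pos j with rfl | hj
  · rw [add_zero, p.place_bottom_of_le le_rfl, StripParams.bottomPos_of_le le_rfl,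
      p.L_mul_one_sub]
    simp
  · simp only [place]
    rw [if_neg (by omega), Nat.add_sub_cancel_left]

theorem place_top (j : ℕ) : p.place (.top j) = (p.w + j * p.g, 1) := rfl

theorem place_slant_last : p.place (.slant p.M) = (p.w, p.ρ) := by
  rw [place_slant, StripParams.slantPos_of_le le_rfl, p.L_mul_one_sub]

theorem place_slant_zero : p.place (.slant 0) = (0, 1) := by
  rw [place_slant, p.strip.slantPos_zero]
  simp

theorem w_pos : 0 < p.w := by
  rw [← p.L_mul_one_sub]
  exact mul_pos p.L_pos (sub_pos.mpr p.strip.rho_lt_one)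

variable {p} {n : ℕ} (hn : stripLength n = 2 * p.M) (hn' : n = 2 * p.M + 1 + 2 * p.m)

noncomputable def triangle (p : PlacementData) (n i : ℕ) (v : Fin 3) : ℝ × ℝ :=
  p.place (nodeTriple n i v)

include hn

theorem triangle_zero : p.triangle n 0 = ![(0, 1), (p.w, p.ρ), (p.w, 1)] := by
  funext v
  rw [triangle, nodeTriple, if_pos rfl, hn, Nat.mul_div_cancel_left _ two_pos]
  fin_cases v
  · exact p.place_slant_zero
  · exact p.place_slant_last
  · simp [place_top]

theorem triangle_plus {i : ℕ} (hi : i < 2 * p.M) (hs : thueMorse (i + 1) = 1) :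
    p.triangle n (i + 1) = ![
      (p.L * (1 - slantPos p.M p.x p.ρ (plusCount i)), slantPos p.M p.x p.ρ (plusCount i)),
      (p.L * (1 - bottomPos p.M p.x p.ρ (minusCount i)), 0),
      (p.L * (1 - slantPos p.M p.x p.ρ (plusCount (i + 1))),
        slantPos p.M p.x p.ρ (plusCount (i + 1)))] := by
  funext v
  have hq : minusCount i ≤ p.M := by
    have := minusCount_two_mul p.M
    have h₂ : minusCount i ≤ minusCount (2 * p.M) :=
      Finset.card_le_card (Finset.filter_subset_filter _ (Finset.Icc_subset_Icc_right hi.le))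
    omega
  rw [triangle, nodeTriple, if_neg (by omega), hn, if_pos (by omega), stripTriangle,
    if_pos hs, Nat.add_sub_cancel]
  fin_cases v
  · exact p.place_slant _
  · exact p.place_bottom_of_le hq
  · exact p.place_slant _

theorem triangle_minus {i : ℕ} (hi : i < 2 * p.M) (hs : thueMorse (i + 1) = -1) :
    p.triangle n (i + 1) = ![
      (p.L * (1 - slantPos p.M p.x p.ρ (plusCount i)), slantPos p.M p.x p.ρ (plusCount i)),
      (p.L * (1 - bottomPos p.M p.x p.ρ (minusCount i)), 0),
      (p.L * (1 - bottomPos p.M p.x p.ρ (minusCount (i + 1))), 0)] := by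
  funext v
  have hq := StripParams.minusCount_lt hi hs
  have hq' : minusCount (i + 1) ≤ p.M := by
    rw [minusCount_succ, if_pos hs]
    omega
  rw [triangle, nodeTriple, if_neg (by omega), hn, if_pos (by omega), stripTriangle,
    if_neg (by omega), Nat.add_sub_cancel]
  fin_cases v
  · exact p.place_slant _
  · exact p.place_bottom_of_le hq.le
  · exact p.place_bottom_of_le hq'

theorem triangle_upper (j : ℕ) : p.triangle n (2 * p.M + 1 + 2 * j) = ![
    (p.w + j * p.g, 1), (p.w + j * p.g, 0), (p.w + (j + 1) * p.g, 1)] := by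
  funext v
  rw [triangle, nodeTriple, if_neg (by omega), hn, if_neg (by omega)]
  rw [show 2 * p.M + 1 + 2 * j - 2 * p.M - 1 = 2 * j by omega, if_pos (by omega),
    Nat.mul_div_cancel_left _ two_pos, Nat.mul_div_cancel_left _ two_pos]
  fin_cases v
  · exact p.place_top _
  · exact p.place_bottom_add _
  · simp [place_top]

theorem triangle_lower (j : ℕ) : p.triangle n (2 * p.M + 1 + (2 * j + 1)) = ![
    (p.w + j * p.g, 0), (p.w + (j + 1) * p.g, 1), (p.w + (j + 1) * p.g, 0)] := by
  funext v
  rw [triangle, nodeTriple, if_neg (by omega), hn, if_neg (by omega)]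
  rw [show 2 * p.M + 1 + (2 * j + 1) - 2 * p.M - 1 = 2 * j + 1 by omega, if_neg (by omega),
    show (2 * j + 1) / 2 = j by omega, Nat.mul_div_cancel_left _ two_pos]
  fin_cases v
  · exact p.place_bottom_add _
  · simp [place_top]
  · simpa [add_assoc] using p.place_bottom_add (j + 1)

/-- The absolute value of the doubled area of the `i`-th triangle. -/
noncomputable def absDoubleArea (p : PlacementData) : ℕ → ℝ
  | 0 => p.g
  | i + 1 => if i < 2 * p.M then
      p.L * (restArea p.M p.x p.ρ i - restArea p.M p.x p.ρ (i + 1)) else p.g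

omit hn in
theorem absDoubleArea_pos (i : ℕ) : 0 < p.absDoubleArea i := by
  rcases i with _ | i
  · exact p.g_pos
  · rw [absDoubleArea]
    split_ifs with h
    · exact mul_pos p.L_pos (sub_pos.mpr (p.strip.restArea_succ_lt h))
    · exact p.g_pos

theorem abs_doubleArea_triangle (i : ℕ) :
    |doubleArea (p.triangle n i)| = p.absDoubleArea i := by
  have hg := p.g_pos
  rcases i with _ | i
  · rw [triangle_zero hn, absDoubleArea]
    refine Eq.trans ?_ (abs_of_pos hg)
    congr 1
    simp only [doubleArea, Matrix.cons_val_zero, Matrix.cons_val_one, Matrix.cons_val]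
    linear_combination p.w_mul_one_sub
  · rcases Nat.lt_or_ge i (2 * p.M) with hi | hi
    · rw [← abs_of_pos (absDoubleArea_pos (p := p) (i + 1)), absDoubleArea, if_pos hi, restArea,
        restArea]
      congr 1
      rcases thueMorse_eq_one_or_neg_one (i + 1) (by omega) with hs | hs
      · rw [triangle_plus hn hi hs, minusCount_succ, if_neg (by omega), add_zero]
        simp only [doubleArea, Matrix.cons_val_zero, Matrix.cons_val_one, Matrix.cons_val]
        ring
      · rw [triangle_minus hn hi hs, plusCount_succ, if_neg (by omega), add_zero]
        simp only [doubleArea, Matrix.cons_val_zero, Matrix.cons_val_one, Matrix.cons_val]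
        ring
    · rw [absDoubleArea, if_neg (by omega)]
      obtain ⟨r, rfl⟩ := Nat.exists_eq_add_of_le hi
      rcases Nat.even_or_odd' r with ⟨j, rfl | rfl⟩
      · rw [show 2 * p.M + 2 * j + 1 = 2 * p.M + 1 + 2 * j by ring, triangle_upper hn]
        refine Eq.trans ?_ (abs_of_pos hg)
        congr 1
        simp only [doubleArea, Matrix.cons_val_zero, Matrix.cons_val_one, Matrix.cons_val]
        ring
      · rw [show 2 * p.M + (2 * j + 1) + 1 = 2 * p.M + 1 + (2 * j + 1) by ring, triangle_lower hn,
          ← abs_neg]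
        refine Eq.trans ?_ (abs_of_pos hg)
        congr 1
        simp only [doubleArea, Matrix.cons_val_zero, Matrix.cons_val_one, Matrix.cons_val]
        ring

omit hn in
include hn' in
-- The strip telescopes to `L * (1 - ρ ^ 2) = w * (1 + ρ)`. With the flat triangle `w * (1 - ρ)` and
-- the pairs `2 * m * g` this makes `2 * (w + m * g)`.
theorem sum_absDoubleArea : ∑ i ∈ Finset.range n, p.absDoubleArea i = 2 := by
  rw [hn', Finset.sum_range_add, Finset.sum_range_succ']
  have h₁ : ∑ i ∈ Finset.range (2 * p.M), p.absDoubleArea (i + 1) = p.L * (1 - p.ρ ^ 2) := by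
    have : ∀ i ∈ Finset.range (2 * p.M), p.absDoubleArea (i + 1) =
        p.L * (restArea p.M p.x p.ρ i - restArea p.M p.x p.ρ (i + 1)) := fun i hi => by
      rw [absDoubleArea, if_pos (Finset.mem_range.mp hi)]
    have hM := p.strip.one_le
    rw [Finset.sum_congr rfl this, ← Finset.mul_sum, Finset.sum_range_sub',
      p.strip.restArea_eq (by omega) (by omega), p.strip.restArea_eq le_rfl (by omega),
      p.strip.rho_sq]
    push_cast
    ring
  have h₂ : ∑ i ∈ Finset.range (2 * p.m), p.absDoubleArea (2 * p.M + 1 + i) = 2 * p.m * p.g := by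
    have : ∀ i ∈ Finset.range (2 * p.m), p.absDoubleArea (2 * p.M + 1 + i) = p.g := fun i _ => by
      rw [show 2 * p.M + 1 + i = 2 * p.M + i + 1 by ring, absDoubleArea, if_neg (by omega)]
    rw [Finset.sum_congr rfl this, Finset.sum_const, Finset.card_range, nsmul_eq_mul]
    push_cast
    ring
  rw [h₁, h₂, absDoubleArea]
  linear_combination (1 + p.ρ) * p.L_mul_one_sub - p.w_mul_one_sub + 2 * p.w_add

omit hn in
theorem place_slant_mem (j : ℕ) : p.place (.slant j) ∈ unitSquare := by
  have h₁ := p.strip.slantPos_le_one j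
  have h₂ := p.strip.rho_le_slantPos j
  have h₃ := p.strip.slantPos_pos (j := j)
  have h₄ := p.L_pos
  have h₅ := p.L_mul_one_sub
  have h₆ := p.w_add
  have h₇ : 0 ≤ p.m * p.g := mul_nonneg (Nat.cast_nonneg _) p.g_pos.le
  rw [place_slant]
  exact ⟨⟨by dsimp only; nlinarith, by dsimp only; nlinarith⟩, h₃.le, h₁⟩

omit hn in
theorem place_bottom_mem (j : ℕ) (hj : j ≤ p.M + p.m) : p.place (.bottom j) ∈ unitSquare := by
  have h₄ := p.L_pos
  have h₅ := p.L_mul_one_sub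
  have h₆ := p.w_add
  have h₇ : 0 ≤ p.m * p.g := mul_nonneg (Nat.cast_nonneg _) p.g_pos.le
  rcases le_total j p.M with h | h
  · have h₁ := p.strip.bottomPos_le_one j
    have h₂ := p.strip.rho_le_bottomPos j
    have h₃ := p.strip.bottomPos_pos (j := j)
    rw [place_bottom_of_le _ h]
    exact ⟨⟨by dsimp only; nlinarith, by dsimp only; nlinarith⟩, le_rfl, zero_le_one⟩
  · obtain ⟨i, rfl⟩ := Nat.exists_eq_add_of_le h
    have hi : (i : ℝ) ≤ p.m := by exact_mod_cast (by omega : i ≤ p.m)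
    have hi' : (i : ℝ) * p.g ≤ p.m * p.g := mul_le_mul_of_nonneg_right hi p.g_pos.le
    have h₈ : 0 ≤ i * p.g := mul_nonneg (Nat.cast_nonneg _) p.g_pos.le
    have hw := p.w_pos
    rw [place_bottom_add]
    exact ⟨⟨by dsimp only; linarith, by dsimp only; linarith⟩, le_rfl, zero_le_one⟩

omit hn in
theorem place_top_mem (i : ℕ) (hi : i ≤ p.m) : p.place (.top i) ∈ unitSquare := by
  have h₆ := p.w_add
  have hi : (i : ℝ) ≤ p.m := by exact_mod_cast hi
  have hi' : (i : ℝ) * p.g ≤ p.m * p.g := mul_le_mul_of_nonneg_right hi p.g_pos.le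
  have h₈ : 0 ≤ i * p.g := mul_nonneg (Nat.cast_nonneg _) p.g_pos.le
  have hw := p.w_pos
  rw [place_top]
  exact ⟨⟨by dsimp only; linarith, by dsimp only; linarith⟩, zero_le_one, le_rfl⟩

include hn' in
theorem triangle_mem_unitSquare {i : ℕ} (hi : i < n) (v : Fin 3) :
    p.triangle n i v ∈ unitSquare := by
  rw [triangle, nodeTriple, hn, Nat.mul_div_cancel_left _ two_pos]
  split_ifs with h₁ h₂
  · fin_cases v
    · exact place_slant_mem _
    · exact place_slant_mem _
    · exact place_top_mem _ (Nat.zero_le _)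
  · have hq : ∀ j ≤ i, minusCount j ≤ p.M + p.m := fun j hj => by
      have := minusCount_two_mul p.M
      have h₂ : minusCount j ≤ minusCount (2 * p.M) :=
        Finset.card_le_card (Finset.filter_subset_filter _
          (Finset.Icc_subset_Icc_right (hj.trans h₂)))
      omega
    rw [stripTriangle]
    fin_cases v
    · exact place_slant_mem _
    · exact place_bottom_mem _ (hq _ (by omega))
    · simp only [Fin.reduceFinMk, Matrix.cons_val]
      split_ifs
      · exact place_slant_mem _
      · exact place_bottom_mem _ (hq _ le_rfl)
  · simp only []
    split_ifs with h₃
    · fin_cases v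
      · exact place_top_mem _ (by omega)
      · exact place_bottom_mem _ (by omega)
      · exact place_top_mem _ (by omega)
    · fin_cases v
      · exact place_bottom_mem _ (by omega)
      · exact place_top_mem _ (by omega)
      · exact place_bottom_mem _ (by omega)

end PlacementData

/-! ### The triangles cover the square -/

theorem mem_convexHull_of_eq {f : Fin 3 → ℝ × ℝ} {z : ℝ × ℝ} (a b c : ℝ) (ha : 0 ≤ a)
    (hb : 0 ≤ b) (hc : 0 ≤ c) (h : a + b + c = 1)
    (h₁ : z.1 = a * (f 0).1 + b * (f 1).1 + c * (f 2).1)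
    (h₂ : z.2 = a * (f 0).2 + b * (f 1).2 + c * (f 2).2) :
    z ∈ convexHull ℝ (Set.range f) := by
  have : z = a • f 0 + b • f 1 + c • f 2 := Prod.ext (by simpa using h₁) (by simpa using h₂)
  rw [this]
  exact mem_convexHull_triple f ha hb hc h

/-- Splitting a number in an interval as a convex combination of the endpoints, scaled by `c`. -/
theorem exists_scaled_combination {a c u u' : ℝ} (hu' : 0 < u') (hu : u' < u) (h₁ : a / u ≤ c)
    (h₂ : c ≤ a / u') : ∃ s t : ℝ, 0 ≤ s ∧ 0 ≤ t ∧ s + t = c ∧ s * u + t * u' = a := by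
  rw [div_le_iff₀ (hu'.trans hu)] at h₁
  rw [le_div_iff₀ hu'] at h₂
  have hd : 0 < u - u' := by linarith
  refine ⟨(a - u' * c) / (u - u'), (u * c - a) / (u - u'), div_nonneg (by linarith) hd.le,
    div_nonneg (by linarith) hd.le, ?_, ?_⟩ <;> field_simp <;> ring

theorem exists_step_crossing (φ : ℕ → ℝ) (N : ℕ) (h₀ : φ 0 ≤ 1) (hN : 1 ≤ φ N) (hpos : 0 < N) :
    ∃ i < N, φ i ≤ 1 ∧ 1 ≤ φ (i + 1) := by
  by_contra! h
  have : ∀ i ≤ N, φ i ≤ 1 ∧ (0 < i → φ i < 1) := by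
    intro i
    induction i with
    | zero => exact fun _ => ⟨h₀, fun h => absurd h (lt_irrefl 0)⟩
    | succ i ih =>
      intro hi
      have := h i (by omega) (ih (by omega)).1
      exact ⟨this.le, fun _ => this⟩
  exact absurd hN (not_le.mpr ((this N le_rfl).2 hpos))

namespace PlacementData

variable {p : PlacementData} {n : ℕ} (hn : stripLength n = 2 * p.M)
  (hn' : n = 2 * p.M + 1 + 2 * p.m)

include hn

/-- In the triangle formed by the left side and the apex, `z` has barycentric coordinates `z.2` and
`β` at the upper and lower left corners. It lies in the part between the apex and the edge at
distances `u`, `v` exactly if `z.2 / u + β / v ≤ 1`. This quantity passes `1` on the way to the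
right end, and the step at which it does so gives the triangle. -/
theorem exists_mem_strip_triangle {z : ℝ × ℝ} (h₁ : z.1 ≤ p.w) (h₂ : 0 ≤ z.1) (h₃ : 0 ≤ z.2)
    (h₄ : z.2 ≤ 1 - z.1 / p.L) :
    ∃ i < 2 * p.M, z ∈ convexHull ℝ (Set.range (p.triangle n (i + 1))) := by
  have hL := p.L_pos
  obtain ⟨β, hβ⟩ : ∃ β, β = 1 - z.1 / p.L - z.2 := ⟨_, rfl⟩
  have hβ0 : 0 ≤ β := by linarith
  have hz : z.1 = p.L * (1 - z.2 - β) := by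
    rw [hβ]
    field_simp
    ring
  have hM := p.strip.one_le
  obtain ⟨i, hi, l₁, l₂⟩ := exists_step_crossing
    (fun i => z.2 / slantPos p.M p.x p.ρ (plusCount i) + β / bottomPos p.M p.x p.ρ (minusCount i))
    (2 * p.M) (by
      have e₁ : plusCount 0 = 0 := plusCount_two_mul 0
      have e₂ : minusCount 0 = 0 := minusCount_two_mul 0
      simp only [e₁, e₂, p.strip.slantPos_zero, p.strip.bottomPos_zero, div_one]
      have : 0 ≤ z.1 / p.L := div_nonneg h₂ hL.le
      linarith) (by
      simp only [plusCount_two_mul, minusCount_two_mul, StripParams.slantPos_of_le le_rfl,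
        StripParams.bottomPos_of_le le_rfl]
      rw [← add_div, one_le_div p.strip.rho_pos]
      have := p.L_mul_one_sub
      by_contra! hc
      nlinarith) (by omega)
  refine ⟨i, hi, ?_⟩
  have hu := p.strip.slantPos_pos (j := plusCount i)
  have hv := p.strip.bottomPos_pos (j := minusCount i)
  rcases thueMorse_eq_one_or_neg_one (i + 1) (by omega) with hs | hs
  · rw [triangle_plus hn hi hs]
    rw [minusCount_succ, if_neg (by omega), add_zero] at l₂
    have hlt := p.strip.slantPos_succ_lt (StripParams.plusCount_lt hi hs)
    have hu' := p.strip.slantPos_pos (j := plusCount (i + 1))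
    rw [plusCount_succ, if_pos hs] at l₂ hu' ⊢
    obtain ⟨s, t, hs0, ht0, hst, hstz⟩ := exists_scaled_combination hu' hlt
      (le_sub_iff_add_le.mpr l₁) (sub_le_iff_le_add.mpr l₂)
    have hb : β / bottomPos p.M p.x p.ρ (minusCount i) * bottomPos p.M p.x p.ρ (minusCount i) =
      β := div_mul_cancel₀ _ hv.ne'
    refine mem_convexHull_of_eq s (β / bottomPos p.M p.x p.ρ (minusCount i)) t hs0
      (div_nonneg hβ0 hv.le) ht0 (by linarith) ?_ ?_
    · simp only [Matrix.cons_val_zero, Matrix.cons_val_one, Matrix.cons_val]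
      rw [hz]
      linear_combination p.L * hstz + p.L * hb - p.L * hst
    · simp only [Matrix.cons_val_zero, Matrix.cons_val_one, Matrix.cons_val]
      linear_combination -hstz
  · rw [triangle_minus hn hi hs]
    rw [plusCount_succ, if_neg (by omega), add_zero] at l₂
    have hlt := p.strip.bottomPos_succ_lt (StripParams.minusCount_lt hi hs)
    have hv' := p.strip.bottomPos_pos (j := minusCount (i + 1))
    rw [minusCount_succ, if_pos hs] at l₂ hv' ⊢
    obtain ⟨s, t, hs0, ht0, hst, hstz⟩ := exists_scaled_combination hv' hlt
      (le_sub_iff_add_le'.mpr l₁) (sub_le_iff_le_add'.mpr l₂)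
    have hb : z.2 / slantPos p.M p.x p.ρ (plusCount i) * slantPos p.M p.x p.ρ (plusCount i) =
      z.2 := div_mul_cancel₀ _ hu.ne'
    refine mem_convexHull_of_eq (z.2 / slantPos p.M p.x p.ρ (plusCount i)) s t
      (div_nonneg h₃ hu.le) hs0 ht0 (by linarith) ?_ ?_
    · simp only [Matrix.cons_val_zero, Matrix.cons_val_one, Matrix.cons_val]
      rw [hz]
      linear_combination p.L * hstz + p.L * hb - p.L * hst
    · simp only [Matrix.cons_val_zero, Matrix.cons_val_one, Matrix.cons_val]
      linear_combination -hb

theorem mem_triangle_zero {z : ℝ × ℝ} (h₁ : z.1 ≤ p.w) (h₃ : z.2 ≤ 1)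
    (h₄ : 1 - z.1 / p.L ≤ z.2) : z ∈ convexHull ℝ (Set.range (p.triangle n 0)) := by
  have hL := p.L_pos
  have hw := p.w_pos
  have hρ : 0 < 1 - p.ρ := sub_pos.mpr p.strip.rho_lt_one
  rw [triangle_zero hn]
  have e : z.1 / p.w = z.1 / p.L / (1 - p.ρ) := by rw [← p.L_mul_one_sub, div_div]
  refine mem_convexHull_of_eq (1 - z.1 / p.w) ((1 - z.2) / (1 - p.ρ))
    (z.1 / p.w - (1 - z.2) / (1 - p.ρ)) ?_ ?_ ?_ (by ring) ?_ ?_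
  · rw [sub_nonneg, div_le_one hw]
    exact h₁
  · exact div_nonneg (by linarith) hρ.le
  · rw [e, ← sub_div]
    exact div_nonneg (by linarith) hρ.le
  · simp only [Matrix.cons_val_zero, Matrix.cons_val_one, Matrix.cons_val]
    field_simp
    ring
  · simp only [Matrix.cons_val_zero, Matrix.cons_val_one, Matrix.cons_val]
    field_simp
    ring

theorem exists_mem_right_triangle {z : ℝ × ℝ} (h₁ : p.w < z.1) (h₂ : z.1 ≤ 1) (h₃ : 0 ≤ z.2)
    (h₄ : z.2 ≤ 1) :
    ∃ r < 2 * p.m, z ∈ convexHull ℝ (Set.range (p.triangle n (2 * p.M + 1 + r))) := by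
  have hg := p.g_pos
  have ht : 0 < (z.1 - p.w) / p.g := div_pos (by linarith) hg
  have htm : (z.1 - p.w) / p.g ≤ p.m := by
    rw [div_le_iff₀ hg]
    linarith [p.w_add]
  have hz : z.1 = p.w + (z.1 - p.w) / p.g * p.g := by
    field_simp
    ring
  generalize (z.1 - p.w) / p.g = t at *
  -- Rounding up puts the right side of the square, `t = m`, into the last column.
  obtain ⟨j, hj⟩ : ∃ j, ⌈t⌉₊ = j + 1 := Nat.exists_eq_succ_of_ne_zero (Nat.ceil_pos.mpr ht).ne'
  have hjm : j + 1 ≤ p.m := hj ▸ Nat.ceil_le.mpr htm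
  have hjt : (j : ℝ) < t := Nat.lt_ceil.mp (by omega)
  have htj : t ≤ j + 1 := by
    have := Nat.le_ceil t
    rw [hj] at this
    exact_mod_cast this
  rcases le_total (t - j) z.2 with h | h
  · refine ⟨2 * j, by omega, ?_⟩
    rw [triangle_upper hn]
    refine mem_convexHull_of_eq (z.2 - (t - j)) (1 - z.2) (t - j) (by linarith) (by linarith)
      (by linarith) (by ring) ?_ ?_
    · simp only [Matrix.cons_val_zero, Matrix.cons_val_one, Matrix.cons_val]
      rw [hz]
      ring
    · simp only [Matrix.cons_val_zero, Matrix.cons_val_one, Matrix.cons_val]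
      ring
  · refine ⟨2 * j + 1, by omega, ?_⟩
    rw [triangle_lower hn]
    refine mem_convexHull_of_eq (1 - (t - j)) z.2 (t - j - z.2) (by linarith) (by linarith)
      (by linarith) (by ring) ?_ ?_
    · simp only [Matrix.cons_val_zero, Matrix.cons_val_one, Matrix.cons_val]
      rw [hz]
      ring
    · simp only [Matrix.cons_val_zero, Matrix.cons_val_one, Matrix.cons_val]
      ring

include hn'

theorem exists_mem_triangle {z : ℝ × ℝ} (hz : z ∈ unitSquare) :
    ∃ i : Fin n, z ∈ convexHull ℝ (Set.range (p.triangle n i)) := by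
  obtain ⟨⟨h₁, h₂⟩, h₃, h₄⟩ := hz
  rcases lt_or_ge p.w z.1 with h | h
  · obtain ⟨r, hr, hmem⟩ := exists_mem_right_triangle hn h h₂ h₃ h₄
    exact ⟨⟨2 * p.M + 1 + r, by omega⟩, hmem⟩
  · rcases le_total z.2 (1 - z.1 / p.L) with h' | h'
    · obtain ⟨i, hi, hmem⟩ := exists_mem_strip_triangle hn h h₁ h₃ h'
      exact ⟨⟨i + 1, by omega⟩, hmem⟩
    · exact ⟨⟨0, by omega⟩, mem_triangle_zero hn h h₄ h'⟩

theorem iUnion_triangle :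
    ⋃ i : Fin n, convexHull ℝ (Set.range (p.triangle n i)) = unitSquare := by
  apply subset_antisymm
  · refine Set.iUnion_subset fun i => convexHull_min ?_ ?_
    · rintro _ ⟨v, rfl⟩
      exact triangle_mem_unitSquare hn hn' i.2 v
    · exact (convex_Icc 0 1).prod (convex_Icc 0 1)
  · exact fun z hz => Set.mem_iUnion.mpr (exists_mem_triangle hn hn' hz)

noncomputable def dissection : Dissection unitSquare n where
  corner i := p.triangle n i
  nondegenerate i := affineIndependent_of_doubleArea_ne_zero _ <| by
    rw [← abs_ne_zero, abs_doubleArea_triangle hn]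
    exact (absDoubleArea_pos _).ne'
  disjoint_interiors := by
    have hvol : MeasureTheory.volume unitSquare = 1 := by
      rw [unitSquare, MeasureTheory.Measure.volume_eq_prod, MeasureTheory.Measure.prod_prod]
      simp
    refine disjoint_interior_of_cover _ unitSquare (iUnion_triangle hn hn') (by simp [hvol]) ?_
    simp_rw [volume_convexHull_triple, abs_doubleArea_triangle hn]
    rw [← ENNReal.ofReal_sum_of_nonneg fun i _ => (half_pos (absDoubleArea_pos _)).le,
      Fin.sum_univ_eq_sum_range (fun i => p.absDoubleArea i / 2), ← Finset.sum_div,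
      sum_absDoubleArea hn', hvol]
    simp
  cover := iUnion_triangle hn hn'

theorem area_dissection (i : Fin n) : (dissection hn hn').area i = p.absDoubleArea i / 2 := by
  rw [Dissection.area, dissection, volume_convexHull_triple, abs_doubleArea_triangle hn,
    ENNReal.toReal_ofReal (half_pos (absDoubleArea_pos _)).le]

omit hn hn' in
theorem absDoubleArea_le (i : ℕ) : p.absDoubleArea i ≤ 2 * p.g := by
  have hg := p.g_pos
  rcases i with _ | i
  · rw [absDoubleArea]
    linarith
  · rw [absDoubleArea]
    split_ifs with h
    · have := p.strip.restArea_sub_le h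
      rw [← p.L_mul_x]
      nlinarith [p.L_pos]
    · linarith

omit hn hn' in
theorem abs_absDoubleArea_sub_le (i : ℕ) : |p.absDoubleArea i - p.g| ≤
    p.L * |plusProd p.x (2 * p.M) - minusProd p.x (2 * p.M)| := by
  have h0 : 0 ≤ p.L * |plusProd p.x (2 * p.M) - minusProd p.x (2 * p.M)| :=
    mul_nonneg p.L_pos.le (abs_nonneg _)
  rcases i with _ | i
  · simpa [absDoubleArea] using h0
  · rw [absDoubleArea]
    split_ifs with h
    · rw [← p.L_mul_x, ← mul_sub, abs_mul, abs_of_pos p.L_pos]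
      exact mul_le_mul_of_nonneg_left (p.strip.abs_restArea_sub_sub_le h) p.L_pos.le
    · simpa using h0

/-- All areas lie between `0` and `g`, as the doubled areas are at most `2 * g`. -/
theorem areaRange_le_gap : (dissection hn hn').areaRange ≤ p.g := by
  have : Nonempty (Fin n × Fin n) := ⟨⟨0, by omega⟩, ⟨0, by omega⟩⟩
  refine ciSup_le fun q => ?_
  rw [area_dissection, area_dissection, abs_le]
  have h₁ := absDoubleArea_le (p := p) q.1
  have h₂ := absDoubleArea_le (p := p) q.2
  have h₃ := absDoubleArea_pos (p := p) q.1
  have h₄ := absDoubleArea_pos (p := p) q.2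
  constructor <;> linarith

/-- Every area differs from `g / 2` by at most half of the right-hand side. -/
theorem areaRange_le : (dissection hn hn').areaRange ≤
    p.L * |plusProd p.x (2 * p.M) - minusProd p.x (2 * p.M)| := by
  have : Nonempty (Fin n × Fin n) := ⟨⟨0, by omega⟩, ⟨0, by omega⟩⟩
  refine ciSup_le fun q => ?_
  rw [area_dissection, area_dissection, abs_le]
  have h₁ := abs_le.mp (abs_absDoubleArea_sub_le (p := p) q.1)
  have h₂ := abs_le.mp (abs_absDoubleArea_sub_le (p := p) q.2)
  constructor <;> linarith [h₁.1, h₁.2, h₂.1, h₂.2]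

omit hn hn' in
theorem sbtw_of_lt (a v : ℝ × ℝ) (hv : v ≠ 0) {r s t : ℝ} (h₁ : r < s) (h₂ : s < t) :
    Sbtw ℝ (a + r • v) (a + s • v) (a + t • v) := by
  have hw : Wbtw ℝ r s t := (wbtw_iff_of_le (h₁.trans h₂).le).mpr ⟨h₁.le, h₂.le⟩
  have hs : Sbtw ℝ r s t := ⟨hw, h₁.ne', h₂.ne⟩
  let f : ℝ →ᵃ[ℝ] ℝ × ℝ := (LinearMap.toSpanSingleton ℝ (ℝ × ℝ) v).toAffineMap +
    AffineMap.const ℝ ℝ a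
  have hf : ∀ r, f r = a + r • v := fun r => by simp [f, add_comm]
  have hinj : Function.Injective f := fun r s hrs => by
    rw [hf, hf, add_right_inj] at hrs
    exact smul_left_injective ℝ hv hrs
  simpa [hf] using (hinj.sbtw_map_iff).mpr hs

omit hn hn' in
theorem sbtw_horizontal {a b c : ℝ} (y : ℝ) (h₁ : a < b) (h₂ : b < c) :
    Sbtw ℝ (a, y) (b, y) (c, y) := by
  simpa using sbtw_of_lt (0, y) (1, 0) (by simp) h₁ h₂

theorem isPlacementOfDn : IsPlacementOfDn (dissection hn hn') p.place := by
  have hM : stripLength n / 2 = p.M := by omega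
  have hm : extraPairs n = p.m := by
    rw [extraPairs, hn]
    omega
  have hL := p.L_pos
  have hg := p.g_pos
  have hw := p.w_pos
  have hbottom : ∀ i j, i < j → j ≤ p.M + p.m → ∃ a b : ℝ,
      p.place (.bottom i) = (a, 0) ∧ p.place (.bottom j) = (b, 0) ∧ a < b := by
    intro i j hij hj
    rcases le_total j p.M with h | h
    · exact ⟨_, _, place_bottom_of_le _ (hij.le.trans h), place_bottom_of_le _ h,
        mul_lt_mul_of_pos_left (sub_lt_sub_left (p.strip.bottomPos_lt hij h) 1) hL⟩
    · obtain ⟨j, rfl⟩ := Nat.exists_eq_add_of_le h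
      rcases Nat.lt_or_ge i p.M with h' | h'
      · refine ⟨_, _, place_bottom_of_le _ h'.le, place_bottom_add _ _, ?_⟩
        have h₁ := p.strip.bottomPos_lt h' le_rfl
        rw [StripParams.bottomPos_of_le le_rfl] at h₁
        have h₂ := mul_lt_mul_of_pos_left (sub_lt_sub_left h₁ 1) hL
        rw [p.L_mul_one_sub] at h₂
        exact h₂.trans_le (le_add_of_nonneg_right (by positivity))
      · obtain ⟨i, rfl⟩ := Nat.exists_eq_add_of_le h'
        refine ⟨_, _, place_bottom_add _ _, place_bottom_add _ _, ?_⟩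
        have : (i : ℝ) < j := by exact_mod_cast (by omega)
        gcongr
  refine ⟨fun _ _ => rfl, p.place_slant_zero, ?_, ?_, ?_, ?_, ?_, ?_, ?_⟩
  · rw [place_bottom_of_le _ (Nat.zero_le _), p.strip.bottomPos_zero]
    simp
  · rw [hM, hm, place_bottom_add, p.w_add]
  · rw [hm, place_top, p.w_add]
  · rw [hM]
    intro i j l hij hjl hl
    have h₁ := p.strip.slantPos_lt hij (hjl.le.trans hl)
    have h₂ := p.strip.slantPos_lt hjl hl
    have := sbtw_of_lt (0, 1) (p.L, -1) (by simp) (sub_lt_sub_left h₁ 1) (sub_lt_sub_left h₂ 1)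
    convert this using 1 <;> simp [place_slant, mul_comm]
  · rw [hM, hm]
    intro i j l hij hjl hl
    obtain ⟨a, b, ea, eb, hab⟩ := hbottom i j hij (by omega)
    obtain ⟨b', c, eb', ec, hbc⟩ := hbottom j l hjl hl
    obtain rfl : b = b' := congrArg Prod.fst (eb.symm.trans eb')
    dsimp only
    rw [ea, eb, ec]
    exact sbtw_horizontal 0 hab hbc
  · rw [hm]
    have key : ∀ i, (if i = 0 then p.place (.slant 0) else p.place (.top (i - 1))) =
        (if i = 0 then 0 else p.w + ((i - 1 : ℕ) : ℝ) * p.g, 1) := by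
      intro i
      split_ifs
      · exact p.place_slant_zero
      · exact p.place_top _
    have hlt : ∀ i j : ℕ, i < j → (if i = 0 then 0 else p.w + ((i - 1 : ℕ) : ℝ) * p.g) <
        (if j = 0 then 0 else p.w + ((j - 1 : ℕ) : ℝ) * p.g) := by
      intro i j hij
      rw [if_neg (by omega : j ≠ 0)]
      split_ifs with h
      · positivity
      · have : ((i - 1 : ℕ) : ℝ) < ((j - 1 : ℕ) : ℝ) := by exact_mod_cast (by omega)
        gcongr
    intro i j l hij hjl _
    dsimp only
    rw [key, key, key]
    exact sbtw_horizontal 1 (hlt i j hij) (hlt j l hjl)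
  · rw [hM, place_slant_last, place_top, ← add_zero p.M, place_bottom_add]
    have := sbtw_of_lt (p.w, 1) (0, -1) (by simp) (sub_pos.mpr p.strip.rho_lt_one)
      (sub_lt_self 1 p.strip.rho_pos)
    simpa using this

end PlacementData

/-! ### Choice of the parameters -/

/-- The placement for which all areas would be equal if the two distances from the apex at the
right end of the strip agreed exactly. -/
noncomputable def balancedPlacement (M m : ℕ) (hM : 1 ≤ M) : PlacementData where
  M := M
  m := m
  -- The equations `L x = g = w (1 - ρ) = L (1 - ρ) ^ 2` give `x = (1 - ρ) ^ 2`, and `ρ ^ 2 = 1 - 2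
  -- M x` becomes `1 + ρ = 2 M (1 - ρ)`. This determines `ρ` and `x`; then `w + m g = 1` fixes `g =
  -- 2 / n`, `w` and `L`.
  x := 4 / (2 * M + 1) ^ 2
  ρ := (2 * M - 1) / (2 * M + 1)
  L := (2 * M + 1) ^ 2 / (2 * (2 * M + 1 + 2 * m))
  w := (2 * M + 1) / (2 * M + 1 + 2 * m)
  g := 2 / (2 * M + 1 + 2 * m)
  strip :=
    { one_le := hM
      x_pos := by positivity
      rho_pos := by
        have : (1 : ℝ) ≤ M := by exact_mod_cast hM
        exact div_pos (by linarith) (by positivity)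
      rho_sq := by
        push_cast
        field_simp
        ring }
  L_pos := by positivity
  g_pos := by positivity
  L_mul_one_sub := by
    field_simp
    ring
  L_mul_x := by
    field_simp
    ring
  w_add := by
    field_simp
  w_mul_one_sub := by
    field_simp
    ring

theorem exists_placement (n : ℕ) (hodd : Odd n) (hn : 3 ≤ n) (k : ℕ) (hk : k = Nat.log 2 n) :
    ∃ (D : Dissection unitSquare n) (P : StripNode → ℝ × ℝ), IsPlacementOfDn D P ∧
      D.areaRange ≤ 2 / n ∧
      D.areaRange ≤ 2 ^ k *
        ((k - 1).factorial * (16 / (2 ^ k) ^ 2) ^ k * 2 ^ (k * (k - 1) / 2)) := by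
  have hk1 : 1 ≤ k := hk ▸ Nat.log_pos one_lt_two (by omega)
  have hkn : 2 ^ k ≤ n := hk ▸ Nat.pow_log_le_self 2 (by omega)
  obtain ⟨M, hM⟩ : ∃ M, M = 2 ^ (k - 1) := ⟨_, rfl⟩
  have hM1 : 1 ≤ M := hM ▸ Nat.one_le_two_pow
  have h2M : 2 ^ k = 2 * M := by
    rw [hM, ← pow_succ']
    congr 1
    omega
  obtain ⟨r, hr⟩ := hodd
  obtain ⟨m, hm⟩ : ∃ m, n = 2 * M + 1 + 2 * m := ⟨r - M, by omega⟩
  have hs : stripLength n = 2 * M := by rw [stripLength, ← hk, h2M]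
  have h2Mr : (2 : ℝ) ^ k = 2 * M := by exact_mod_cast h2M
  have hnr : (n : ℝ) = 2 * M + 1 + 2 * m := by exact_mod_cast hm
  have hMr : (1 : ℝ) ≤ M := by exact_mod_cast hM1
  have hmr : (0 : ℝ) ≤ m := Nat.cast_nonneg m
  let p := balancedPlacement M m hM1
  refine ⟨PlacementData.dissection (p := p) hs hm, p.place,
    PlacementData.isPlacementOfDn (p := p) hs hm, ?_, ?_⟩
  · refine (PlacementData.areaRange_le_gap (p := p) hs hm).trans_eq ?_
    rw [hnr]
    rfl
  · refine (PlacementData.areaRange_le (p := p) hs hm).trans ?_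
    have hL : p.L ≤ 2 ^ k := by
      change (2 * (M : ℝ) + 1) ^ 2 / (2 * (2 * M + 1 + 2 * m)) ≤ _
      rw [h2Mr, div_le_iff₀ (by positivity)]
      nlinarith
    have hx := p.strip.x_pos
    have hρ := pow_pos p.strip.rho_pos 2
    have hlog := abs_plusProd_sub_minusProd_le hx (p.strip.mul_lt_one (i := 2 * p.M) le_rfl)
    have hsum := abs_thueMorse_log_sum_le k hk1 p.x (p.ρ ^ 2) hx hρ (by
      rw [p.strip.rho_sq, h2Mr]
      apply le_of_eq
      push_cast
      rfl)
    rw [h2M] at hsum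
    -- The quotient is `4 / (2 M - 1) ^ 2`, and `2 M - 1 ≥ M`.
    have hδ : p.x / p.ρ ^ 2 ≤ 16 / (2 ^ k) ^ 2 := by
      change 4 / (2 * (M : ℝ) + 1) ^ 2 / ((2 * (M : ℝ) - 1) / (2 * M + 1)) ^ 2 ≤ _
      have h₁ : 0 < 2 * (M : ℝ) - 1 := by linarith
      have : 4 / (2 * (M : ℝ) + 1) ^ 2 / ((2 * (M : ℝ) - 1) / (2 * M + 1)) ^ 2 =
          4 / (2 * (M : ℝ) - 1) ^ 2 := by field_simp
      rw [this, h2Mr, div_le_div_iff₀ (by positivity) (by positivity)]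
      nlinarith
    have hδ0 : 0 ≤ p.x / p.ρ ^ 2 := (div_pos hx hρ).le
    refine mul_le_mul hL (hlog.trans (hsum.trans ?_)) (abs_nonneg _) (by positivity)
    gcongr

/-! ### Numerical estimates and conclusion -/

/-- The spare factor of order `2 ^ (k ^ 2 / 2)` in the error, with `k = j + 1`, absorbs the
factorial. A step multiplies the left side by `8 (j + 1) (j + 3) / (j + 2)` and the right side by `2
^ (j + 2)`; the inequality fails at `j = 7`. -/
theorem factorial_mul_two_pow_le (j : ℕ) (hj : 8 ≤ j) :
    j.factorial * (j + 2) * 2 ^ (3 * (j + 1)) ≤ 4 * 2 ^ ((j + 1) * (j + 2) / 2) := by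
  induction j, hj using Nat.le_induction with
  | base => decide
  | succ j hj ih =>
    have hpow : 2 * (j + 2) ≤ 2 ^ j := by
      clear ih
      induction j, hj using Nat.le_induction with
      | base => decide
      | succ j hj ih => rw [pow_succ]; omega
    have e : (j + 1 + 1) * (j + 1 + 2) / 2 = (j + 1) * (j + 2) / 2 + (j + 2) := by
      rw [← Nat.add_mul_div_left _ _ (by norm_num : 0 < 2)]
      congr 1
      ring
    rw [e, Nat.factorial_succ, pow_add 2 _ (j + 2)]
    refine Nat.le_of_mul_le_mul_left (c := j + 2) ?_ (by omega)
    calc (j + 2) * ((j + 1) * j.factorial * (j + 1 + 2) * 2 ^ (3 * (j + 1 + 1)))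
        = (j.factorial * (j + 2) * 2 ^ (3 * (j + 1))) * (8 * ((j + 1) * (j + 3))) := by
          rw [show 3 * (j + 1 + 1) = 3 * (j + 1) + 3 by ring, pow_add 2 _ 3]
          ring
      _ ≤ (4 * 2 ^ ((j + 1) * (j + 2) / 2)) * (4 * (2 * (j + 2)) * (j + 2)) := by
          refine Nat.mul_le_mul ih ?_
          nlinarith
      _ ≤ (4 * 2 ^ ((j + 1) * (j + 2) / 2)) * (4 * 2 ^ j * (j + 2)) := by gcongr
      _ = _ := by
          rw [pow_add 2 j 2]
          ring

/-- The size of the error for `k ≥ 9` is at most `4 ^ (k + 1) / (2 ^ (k ^ 2) * (k + 1))`. -/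
theorem error_bound (k : ℕ) (hk : 9 ≤ k) :
    (2 : ℝ) ^ k * ((k - 1).factorial * (16 / (2 ^ k) ^ 2) ^ k * 2 ^ (k * (k - 1) / 2)) ≤
      4 * 4 ^ k / (2 ^ (k ^ 2) * (k + 1)) := by
  obtain ⟨j, rfl⟩ : ∃ j, k = j + 1 := ⟨k - 1, by omega⟩
  have h : ((j.factorial * (j + 2) * 2 ^ (3 * (j + 1)) : ℕ) : ℝ) ≤
      (4 * 2 ^ ((j + 1) * (j + 2) / 2) : ℕ) := by
    exact_mod_cast factorial_mul_two_pow_le j (by omega)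
  push_cast at h
  have e : (j + 1) ^ 2 = (j + 1) * (j + 2) / 2 + (j + 1) * j / 2 := by
    have h₁ : 2 ∣ (j + 1) * (j + 2) := (Nat.even_mul_succ_self (j + 1)).two_dvd
    have h₂ : 2 ∣ (j + 1) * j := by
      rw [mul_comm]
      exact (Nat.even_mul_succ_self j).two_dvd
    rw [← Nat.add_div_of_dvd_right h₁, show (j + 1) * (j + 2) + (j + 1) * j = 2 * (j + 1) ^ 2 by
      ring, Nat.mul_div_cancel_left _ two_pos]
  have e₂ : (16 / ((2 : ℝ) ^ (j + 1)) ^ 2) ^ (j + 1) =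
      16 ^ (j + 1) / (2 ^ ((j + 1) ^ 2) * 2 ^ ((j + 1) ^ 2)) := by
    rw [div_pow, ← pow_mul, ← pow_mul, ← pow_add]
    congr 2
    ring
  rw [Nat.add_sub_cancel, e₂, le_div_iff₀ (by positivity)]
  have e₃ : (2 : ℝ) ^ ((j + 1) ^ 2) =
    2 ^ ((j + 1) * (j + 2) / 2) * 2 ^ ((j + 1) * j / 2) := by rw [← pow_add, ← e]
  have e₄ : (16 : ℝ) ^ (j + 1) = 2 ^ (2 * (j + 1)) * 4 ^ (j + 1) := by
    rw [pow_mul, ← mul_pow]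
    norm_num
  have e₅ : (2 : ℝ) ^ (3 * (j + 1)) = 2 ^ (j + 1) * 2 ^ (2 * (j + 1)) := by
    rw [← pow_add]
    congr 1
    ring
  rw [e₄]
  rw [e₅] at h
  calc (2 : ℝ) ^ (j + 1) * (j.factorial * (2 ^ (2 * (j + 1)) * 4 ^ (j + 1) /
        (2 ^ ((j + 1) ^ 2) * 2 ^ ((j + 1) ^ 2))) * 2 ^ ((j + 1) * j / 2)) *
        (2 ^ ((j + 1) ^ 2) * ((j + 1 : ℕ) + 1))
      = j.factorial * (j + 2) * (2 ^ (j + 1) * 2 ^ (2 * (j + 1))) * 4 ^ (j + 1) *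
        2 ^ ((j + 1) * j / 2) / 2 ^ ((j + 1) ^ 2) := by
        push_cast
        field_simp
        ring
    _ ≤ 4 * 2 ^ ((j + 1) * (j + 2) / 2) * 4 ^ (j + 1) *
        2 ^ ((j + 1) * j / 2) / 2 ^ ((j + 1) ^ 2) := by gcongr
    _ = 4 * 4 ^ (j + 1) := by
        rw [e₃]
        field_simp

section

variable {n k : ℕ} (hn : 3 ≤ n) (hk : k = Nat.log 2 n)

include hn hk

theorem logb_le : Real.logb 2 n ≤ k + 1 := by
  have h : (n : ℝ) < 2 ^ (k + 1) := by
    exact_mod_cast hk ▸ Nat.lt_pow_succ_log_self one_lt_two n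
  rw [Real.logb_le_iff_le_rpow one_lt_two (by positivity)]
  exact_mod_cast h.le

omit hk in
theorem one_le_logb : 1 ≤ Real.logb 2 n := by
  have : (3 : ℝ) ≤ n := by exact_mod_cast hn
  rw [Real.le_logb_iff_rpow_le one_lt_two (by linarith)]
  norm_num
  linarith

theorem rpow_logb_le : (n : ℝ) ^ Real.logb 2 n ≤ 2 ^ ((k + 1) ^ 2) := by
  have h : (n : ℝ) ≤ 2 ^ (k + 1) := by
    exact_mod_cast (hk ▸ Nat.lt_pow_succ_log_self one_lt_two n).le
  have h1 : (1 : ℝ) ≤ n := by exact_mod_cast (by omega : 1 ≤ n)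
  calc (n : ℝ) ^ Real.logb 2 n ≤ (n : ℝ) ^ ((k + 1 : ℕ) : ℝ) :=
        Real.rpow_le_rpow_of_exponent_le h1 (by exact_mod_cast logb_le hn hk)
    _ = (n : ℝ) ^ (k + 1) := Real.rpow_natCast _ _
    _ ≤ (2 ^ (k + 1)) ^ (k + 1) := by gcongr
    _ = _ := by rw [← pow_mul, sq]

/-- The left side equals `8 (2 ^ k) ^ 4 / (2 ^ ((k + 1) ^ 2) (k + 1))`: in the target, `n` is
bounded below by `2 ^ k` in the numerator and above by `2 ^ (k + 1)` in the denominator. -/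
theorem le_superpolyBound (C : ℝ) (hC : 0 ≤ C) :
    4 * 4 ^ k / (2 ^ (k ^ 2) * (k + 1)) ≤ superpolyBound C n := by
  have h₀ : (0 : ℝ) < n := by exact_mod_cast (by omega : 0 < n)
  have h₁ : (2 : ℝ) ^ k ≤ n := by exact_mod_cast hk ▸ Nat.pow_log_le_self 2 (by omega)
  have h₂ := one_le_logb hn
  have h₃ : 0 ≤ Real.log n := Real.log_natCast_nonneg n
  calc 4 * 4 ^ k / ((2 : ℝ) ^ (k ^ 2) * (k + 1))
      = 8 * (2 ^ k) ^ 4 / (2 ^ ((k + 1) ^ 2) * (k + 1)) := by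
        rw [show (4 : ℝ) = 2 ^ 2 by norm_num, ← pow_mul, ← pow_mul,
          show (k + 1) ^ 2 = k ^ 2 + 2 * k + 1 by ring, pow_succ, pow_add,
          show k * 4 = 2 * k + 2 * k by ring, pow_add 2 (2 * k)]
        field_simp
        norm_num
        ring
    _ ≤ 8 * (n : ℝ) ^ 4 / ((n : ℝ) ^ Real.logb 2 n * Real.logb 2 n) := by
        gcongr
        · exact rpow_logb_le hn hk
        · exact logb_le hn hk
    _ ≤ superpolyBound C n := by
        rw [superpolyBound]
        refine le_mul_of_one_le_right (by positivity) ?_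
        have : 0 ≤ C * (Real.log n / n) := by positivity
        linarith

/-- For the finitely many `n < 2 ^ 9` the constant `2 ^ 100` outweighs the denominator, which is at
most `2 ^ 81 * 9`, so the trivial bound on the range suffices. -/
theorem one_le_superpolyBound (hk9 : k < 9) : 1 ≤ superpolyBound (2 ^ 100) n := by
  have h₀ : (1 : ℝ) ≤ n := by exact_mod_cast (by omega : 1 ≤ n)
  have hn9 : (n : ℝ) ≤ 2 ^ 9 := by
    have h : n < 2 ^ (k + 1) := hk ▸ Nat.lt_pow_succ_log_self one_lt_two n
    have : 2 ^ (k + 1) ≤ 2 ^ 9 := Nat.pow_le_pow_right two_pos (by omega)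
    exact_mod_cast (h.trans_le this).le
  have h₂ := one_le_logb hn
  have h₃ : Real.logb 2 n ≤ 9 := by
    have : (k : ℝ) + 1 ≤ 9 := by exact_mod_cast (by omega)
    exact (logb_le hn hk).trans this
  have h₄ : (n : ℝ) ^ Real.logb 2 n ≤ 2 ^ 81 := by
    refine (rpow_logb_le hn hk).trans ?_
    have : (k + 1) ^ 2 ≤ 9 ^ 2 := Nat.pow_le_pow_left (by omega) 2
    exact pow_le_pow_right₀ one_le_two this
  have h₅ : 1 ≤ Real.log n := by
    rw [Real.le_log_iff_exp_le (by linarith)]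
    have : (3 : ℝ) ≤ n := by exact_mod_cast hn
    linarith [Real.exp_one_lt_d9]
  rw [superpolyBound]
  calc (1 : ℝ) ≤ 8 * 1 ^ 4 / (2 ^ 81 * 9) * (1 + 2 ^ 100 * (1 / 2 ^ 9)) := by norm_num
    _ ≤ _ := by gcongr

end

/-- Apart from `n ^ 4 / n ^ (log₂ n)`, the bound is a factor `Y` between `1 / n` and `8 (1 + C)`.
Hence `Y` is a bounded power of `n`, and `c` is `4` plus its exponent. -/
theorem superpolyBound_eq_rpow (C : ℝ) (hC : 0 < C) (n : ℕ) (hn : 3 ≤ n) :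
    ∃ c : ℝ, |c| ≤ 5 + Real.log (8 * (1 + C)) ∧
      superpolyBound C n = 1 / (n : ℝ) ^ (Real.logb 2 n - c) := by
  have h₀ : (3 : ℝ) ≤ n := by exact_mod_cast hn
  have hpos : (0 : ℝ) < n := by linarith
  have h₂ := one_le_logb hn
  have h₅ : 1 ≤ Real.log n := by
    rw [Real.le_log_iff_exp_le hpos]
    linarith [Real.exp_one_lt_d9]
  have hln : Real.log n ≤ n := (Real.log_le_sub_one_of_pos hpos).trans (by linarith)
  have hlb : Real.logb 2 n ≤ n := by
    rw [Real.logb_le_iff_le_rpow one_lt_two hpos, Real.rpow_natCast]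
    exact_mod_cast (Nat.lt_two_pow_self (n := n)).le
  obtain ⟨Y, hY⟩ : ∃ Y, Y = 8 * (1 + C * (Real.log n / n)) / Real.logb 2 n := ⟨_, rfl⟩
  have hdiv : Real.log n / n ≤ 1 := (div_le_one hpos).mpr hln
  have hdiv0 : 0 ≤ Real.log n / n := by positivity
  have hY0 : 0 < Y := by rw [hY]; positivity
  have hYle : Y ≤ 8 * (1 + C) := by
    rw [hY, div_le_iff₀ (by linarith)]
    have : C * (Real.log n / n) ≤ C := mul_le_of_le_one_right hC.le hdiv
    nlinarith
  have hYge : (n : ℝ)⁻¹ ≤ Y := by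
    rw [hY, ← one_div]
    gcongr
    nlinarith
  have l₁ : Real.log Y ≤ Real.log (8 * (1 + C)) := Real.log_le_log hY0 hYle
  have l₂ : -Real.log n ≤ Real.log Y := by
    rw [← Real.log_inv]
    exact Real.log_le_log (by positivity) hYge
  have l₃ : 0 ≤ Real.log (8 * (1 + C)) := Real.log_nonneg (by linarith)
  refine ⟨4 + Real.log Y / Real.log n, ?_, ?_⟩
  · have a₁ : Real.log Y / Real.log n ≤ Real.log (8 * (1 + C)) := by
      rw [div_le_iff₀ (by linarith)]
      nlinarith
    have a₂ : -1 ≤ Real.log Y / Real.log n := by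
      rw [le_div_iff₀ (by linarith)]
      linarith
    rw [abs_le]
    constructor <;> linarith
  · have e : (n : ℝ) ^ (Real.log Y / Real.log n) = Y := by
      rw [Real.rpow_def_of_pos hpos, mul_div_cancel₀ _ (by linarith), Real.exp_log hY0]
    rw [one_div, ← Real.rpow_neg hpos.le, neg_sub, Real.rpow_sub hpos, Real.rpow_add hpos, e,
      superpolyBound, hY]
    have : (n : ℝ) ^ (4 : ℝ) = (n : ℝ) ^ 4 := by exact_mod_cast Real.rpow_natCast (n : ℝ) 4
    rw [this]
    field_simp

theorem minAreaRange_le {n : ℕ} (D : Dissection unitSquare n) : minAreaRange n ≤ D.areaRange :=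
  ciInf_le ⟨0, by
    rintro _ ⟨D, rfl⟩
    exact Real.iSup_nonneg fun _ => abs_nonneg _⟩ D

theorem theorem6p4 :
    (∃ C > (0 : ℝ), ∃ C' > (0 : ℝ), ∀ n : ℕ, Odd n → 3 ≤ n →
      (∃ (D : Dissection unitSquare n) (P : StripNode → ℝ × ℝ),
        IsPlacementOfDn D P ∧ D.areaRange ≤ superpolyBound C n) ∧
      (∃ c : ℝ, |c| ≤ C' ∧ superpolyBound C n = 1 / (n : ℝ) ^ (Real.logb 2 n - c))) ∧
    (∃ c > (0 : ℝ), ∀ n : ℕ, Odd n → 3 ≤ n →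
      minAreaRange n ≤ (2 : ℝ) ^ (-(c * Real.logb 2 n ^ 2))) := by
  have hsmall : ∀ n : ℕ, 3 ≤ n → (2 : ℝ) / n ≤ 2 / 3 := fun n hn => by
    have : (3 : ℝ) ≤ n := by exact_mod_cast hn
    gcongr
  -- The constant `1 / 200` is far from optimal: for `log₂ n ≤ 9` it only needs `81 / 200 ≤ 1 / 2`,
  -- because `2 / 3 ≤ 2 ^ (-1/2)`; for larger `n` the exponent `2 + 2 k - k ^ 2` leaves ample room.
  refine ⟨⟨2 ^ 100, by positivity, 5 + Real.log (8 * (1 + 2 ^ 100)), ?_, fun n hodd hn => ⟨?_,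
    superpolyBound_eq_rpow _ (by positivity) n hn⟩⟩, 1 / 200, by norm_num, fun n hodd hn => ?_⟩
  · have := Real.log_nonneg (x := 8 * (1 + 2 ^ 100)) (by norm_num)
    linarith
  · obtain ⟨D, P, hDP, h₁, h₂⟩ := exists_placement n hodd hn _ rfl
    refine ⟨D, P, hDP, ?_⟩
    rcases Nat.lt_or_ge (Nat.log 2 n) 9 with hk | hk
    · linarith [hsmall n hn, one_le_superpolyBound hn rfl hk]
    · exact h₂.trans ((error_bound _ hk).trans (le_superpolyBound hn rfl _ (by positivity)))
  · obtain ⟨D, P, -, h₁, h₂⟩ := exists_placement n hodd hn _ rfl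
    refine (minAreaRange_le D).trans ?_
    have hlb := logb_le hn rfl
    have hlb1 := one_le_logb hn
    rcases Nat.lt_or_ge (Nat.log 2 n) 9 with hk | hk
    · refine (h₁.trans (hsmall n hn)).trans ?_
      have hk9 : (Nat.log 2 n : ℝ) + 1 ≤ 9 := by exact_mod_cast (by omega)
      calc (2 : ℝ) / 3 ≤ 2 ^ (-(1 / 2 : ℝ)) := by
            rw [Real.rpow_neg two_pos.le, ← Real.sqrt_eq_rpow, ← one_div,
              div_le_div_iff₀ (by norm_num) (by positivity)]
            have := Real.sqrt_lt' (x := 2) (y := 3 / 2) (by norm_num)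
            linarith [this.mpr (by norm_num)]
        _ ≤ _ := Real.rpow_le_rpow_of_exponent_le one_le_two (by nlinarith)
    · refine (h₂.trans (error_bound _ hk)).trans ?_
      generalize Nat.log 2 n = k at *
      have hk9 : (9 : ℝ) ≤ k := by exact_mod_cast hk
      calc 4 * 4 ^ k / ((2 : ℝ) ^ (k ^ 2) * (k + 1)) ≤ 4 * 4 ^ k / ((2 : ℝ) ^ (k ^ 2) * 1) := by
            gcongr
            linarith
        _ = 2 ^ ((2 + 2 * k : ℝ) - k ^ 2) := by
            rw [Real.rpow_sub two_pos, Real.rpow_add two_pos, Real.rpow_mul two_pos.le, mul_one]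
            norm_cast
        _ ≤ _ := Real.rpow_le_rpow_of_exponent_le one_le_two (by nlinarith)
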